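/- Let $\mathfrak g$ be a finite-dimensional complex semisimple Lie algebra with a nonsingular symmetric $\mathrm{ad}$-invariant bilinear form $(\cdot,\cdot)$, and let $\mathfrak r\subset\mathfrak g$ be a reductive Lie subalgebra on which the form is nonsingular. Let $\mathfrak p$ be the orthocomplement of $\mathfrak r$ in $\mathfrak g$ and let $C(\mathfrak p)$ be the Clifford algebra of $\mathfrak p$, with relations $zw+wz=2(z,w)$; as a vector space it is identified with $\wedge\mathfrak p$. Let $\mathfrak h$ be a Cartan subalgebra of $\mathfrak g$ that contains a Cartan subalgebra of $\mathfrak r$, so that $\mathfrak h_{\mathfrak r}=\mathfrak h\cap\mathfrak r$ is a Cartan subalgebra of $\mathfrak r$, and put $\mathfrak h_{\mathfrak p}=\mathfrak h\cap\mathfrak p$. Let $\mathfrak h^{\#}$ be the real subspace of $\mathfrak h$ on which all roots are real, and $\kappa:\mathfrak h=\mathfrak h^{\#}\oplus i\mathfrak h^{\#}\to\mathfrak h^{\#}$ the projection. Choose $f_{\mathfrak r}\in\kappa(\mathfrak h_{\mathfrak r})$ whose centralizer in $\mathfrak g$ is the centralizer of $\mathfrak h_{\mathfrak r}$, and a regular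 element $f\in\mathfrak h^{\#}$ in the interior of a closed Weyl chamber containing $f_{\mathfrak r}$. Let $\Delta_+$ be the set of roots that are positive on $f$, $\rho$ half the sum of $\Delta_+$, $\mathfrak n$ the sum of the root spaces of the roots in $\Delta_+$, and $\mathfrak b=\mathfrak h+\mathfrak n$. Let $u\in C(\mathfrak p)$ be the product, in any order, of a basis of $\mathfrak n\cap\mathfrak p$; let $L=C(\mathfrak p)u$, a left $C(\mathfrak p)$-module, and let $C(\mathfrak h_{\mathfrak p})\subset C(\mathfrak p)$ be the subalgebra generated by $\mathfrak h_{\mathfrak p}$. The cubic Dirac operator is $\square=\sum_i z_i\otimes z_i+1\otimes v\in U(\mathfrak g)\otimes C(\mathfrak p)$, where $\{z_i\}$ is an orthonormal basis of $\mathfrak p$ and $v\in\wedge^3\mathfrak p$ is the element with $([x,x'],x'')=-2(v,x\wedge x'\wedge x'')$ for all $x,x',x''\in\mathfrak p$; here $(w_1\wedge w_2\wedge w_3,\,z_1\wedge z_2\wedge z_3)=\det(w_i,z_j)$. For a $\mathfrak g$-module $V$ let $\square_V$ be the action of $\square$ on $V\otimes L$, where $U(\mathfrak g)$ acts on $V$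 and $C(\mathfrak p)$ acts on $L$, and put $$H_D(V\otimes L)=\operatorname{Ker}\square_V/(\operatorname{Ker}\square_V\cap\operatorname{Im}\square_V).$$ **Theorem.** Let $\lambda\in\mathfrak h^*$ be such that $\lambda+\rho$ vanishes on $\mathfrak h_{\mathfrak p}$, let $V_\lambda$ be the irreducible $\mathfrak g$-module with highest weight $\lambda$ with respect to $\mathfrak b$, and let $v_\lambda\neq 0$ be a highest weight vector in it. Then $\dim C(\mathfrak h_{\mathfrak p})u=2^{k}$ with $k=\dim\mathfrak h_{\mathfrak p}$, one has $\mathbb C v_\lambda\otimes C(\mathfrak h_{\mathfrak p})u\subset\operatorname{Ker}\square_{V_\lambda}$, and the map from cocycle to cohomology class $$\mathbb C v_\lambda\otimes C(\mathfrak h_{\mathfrak p})u\to H_D(V_\lambda\otimes L)$$ is injective. Its image is thus a $2^k$-dimensional subspace of $H_D(V_\lambda\otimes L)$; in particular $H_D(V_\lambda\otimes L)\neq 0$. -/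

import Mathlib

open scoped TensorProduct

noncomputable section

namespace CubicDirac

/-! ### The Lie algebra data -/

/-- A (finite-dimensional, complex) Lie algebra is reductive if its radical is its center. -/
def IsReductive (r : Type*) [LieRing r] [LieAlgebra ℂ r] : Prop :=
  LieAlgebra.radical ℂ r = LieAlgebra.center ℂ r

variable {g : Type*} [LieRing g] [LieAlgebra ℂ g]

/-- The orthocomplement `𝔭` of the subalgebra `𝔯` with respect to the bilinear form `B`. -/
def pPart (B : LinearMap.BilinForm ℂ g) (r : LieSubalgebra ℂ g) : Submodule ℂ g :=
  B.orthogonal r.toSubmodule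

/-- The restriction `B_𝔭` of the bilinear form `B` to `𝔭`. -/
def pForm (B : LinearMap.BilinForm ℂ g) (r : LieSubalgebra ℂ g) :
    LinearMap.BilinForm ℂ (pPart B r) :=
  B.restrict (pPart B r)

/-- The intersection `𝔥_𝔯 = 𝔥 ∩ 𝔯`, as a subalgebra of `𝔯`. -/
def hr (h r : LieSubalgebra ℂ g) : LieSubalgebra ℂ r :=
  h.comap r.incl

/-- The intersection `𝔥_𝔭 = 𝔥 ∩ 𝔭`, as a subspace of `𝔭`. -/
def hp (B : LinearMap.BilinForm ℂ g) (h r : LieSubalgebra ℂ g) : Submodule ℂ (pPart B r) :=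
  h.toSubmodule.comap (pPart B r).subtype

section Positive

variable [FiniteDimensional ℂ g] (h : LieSubalgebra ℂ g) [h.IsCartanSubalgebra]

/-- An element of the Cartan subalgebra is hyperbolic if all roots take real values on it. -/
def IsHyperbolic (x : h) : Prop :=
  ∀ α ∈ h.root, (α x).im = 0

/-- `y` is hyperbolic and `x - y` is `i` times a hyperbolic element: that is, `y` is the image of
`x` under the real projection of `𝔥 = 𝔥^# ⊕ i𝔥^#` onto the space `𝔥^#` of hyperbolic elements. -/
def IsHyperbolicPart (x y : h) : Prop :=
  IsHyperbolic h y ∧ IsHyperbolic h (Complex.I • (x - y))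

/-- The elements `f_𝔯`, `f` of the Cartan subalgebra which determine the Borel subalgebra:
`f_𝔯` is the hyperbolic part of an element of `𝔥_𝔯`, and has the same centralizer in `𝔤` as
`𝔥_𝔯`; `f` is regular and hyperbolic, and `f_𝔯` lies in the closed Weyl chamber of `f`. -/
structure IsAdapted (r : LieSubalgebra ℂ g) (fr f : h) : Prop where
  exists_part : ∃ x : h, (x : g) ∈ r ∧ IsHyperbolicPart h x fr
  centralizer : ∀ y : g, ⁅(fr : g), y⁆ = 0 ↔ ∀ x : g, x ∈ h → x ∈ r → ⁅x, y⁆ = 0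
  hyperbolic : IsHyperbolic h f
  regular : ∀ α ∈ h.root, α f ≠ 0
  chamber : ∀ α ∈ h.root, 0 < (α f).re → 0 ≤ (α fr).re

open scoped Classical in
/-- The positive roots: the roots which are positive on the regular hyperbolic element `f`. -/
def posRoots (f : h) : Finset (LieModule.Weight ℂ h g) :=
  h.root.filter (fun α => 0 < (α f).re)

/-- Half the sum of the positive roots. -/
def rho (f : h) : Module.Dual ℂ h :=
  (1 / 2 : ℂ) • ∑ α ∈ posRoots h f, α.toLinear

/-- The sum `𝔫` of the root spaces of the positive roots. (The Borel subalgebra is `𝔥 + 𝔫`.) -/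
def nPart (f : h) : Submodule ℂ g :=
  ⨆ α ∈ posRoots h f, (LieAlgebra.rootSpace h α).toSubmodule

/-- The intersection `𝔫_𝔭 = 𝔫 ∩ 𝔭`, as a subspace of `𝔭`. -/
def np (B : LinearMap.BilinForm ℂ g) (r : LieSubalgebra ℂ g) (f : h) :
    Submodule ℂ (pPart B r) :=
  (nPart h f).comap (pPart B r).subtype

/-- `V` is the irreducible highest weight module of highest weight `lam` with respect to the Borel
subalgebra `𝔟 = 𝔥 + 𝔫`, and `v` is a highest weight vector in it. -/
structure IsIrreducibleHighestWeight (f : h) (lam : Module.Dual ℂ h)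
    (V : Type*) [AddCommGroup V] [Module ℂ V] [LieRingModule g V] [LieModule ℂ g V]
    (v : V) : Prop where
  irreducible : LieModule.IsIrreducible ℂ g V
  ne_zero : v ≠ 0
  weight : ∀ x : h, ⁅(x : g), v⁆ = lam x • v
  annihilated : ∀ x ∈ nPart h f, ⁅x, v⁆ = 0

end Positive

/-! ### The Clifford algebra and the cubic Dirac operator -/

variable (B : LinearMap.BilinForm ℂ g) (r : LieSubalgebra ℂ g)

/-- The quadratic form `z ↦ (z, z)` on `𝔭`. -/
def pQuad : QuadraticForm ℂ (pPart B r) :=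
  LinearMap.BilinMap.toQuadraticMap (pForm B r)

/-- The Clifford algebra `C(𝔭)`, in which `z w + w z = 2 (z, w)` for `z, w ∈ 𝔭`. -/
abbrev Cl : Type _ := CliffordAlgebra (pQuad B r)

/-- The subalgebra `C(𝔞)` of `C(𝔭)` generated by a subspace `𝔞` of `𝔭`. -/
def clSub (a : Submodule ℂ (pPart B r)) : Subalgebra ℂ (Cl B r) :=
  Algebra.adjoin ℂ (CliffordAlgebra.ι (pQuad B r) '' (a : Set (pPart B r)))

/-- The bilinear form on `⋀³𝔭` which satisfies
`(w₁ ∧ w₂ ∧ w₃, z₁ ∧ z₂ ∧ z₃) = det (wᵢ, zⱼ)`. -/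
def cubeForm : ⋀[ℂ]^3 (pPart B r) →ₗ[ℂ] ⋀[ℂ]^3 (pPart B r) →ₗ[ℂ] ℂ :=
  exteriorPower.pairingDual ℂ (pPart B r) 3 ∘ₗ exteriorPower.map 3 (pForm B r)

section Basis

variable {ι : Type*} [Fintype ι] (z : Module.Basis ι ℂ (pPart B r))

/-- `z` is an orthonormal basis of `𝔭` with respect to `B_𝔭`. -/
def IsOrthonormalBasis : Prop :=
  (∀ i, pForm B r (z i) (z i) = 1) ∧ ∀ i j, i ≠ j → pForm B r (z i) (z j) = 0

/-- The element `v ∈ ⋀³𝔭`, written out in an orthonormal basis of `𝔭`. By `cubeForm_cubicElement`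
it is the element such that `([x, x'], x'') = -2 (v, x ∧ x' ∧ x'')` for all `x, x', x'' ∈ 𝔭`. -/
def cubicElement : ⋀[ℂ]^3 (pPart B r) :=
  (-1 / 12 : ℂ) • ∑ i, ∑ j, ∑ k, B ⁅(z i : g), (z j : g)⁆ (z k) •
    exteriorPower.ιMulti ℂ 3 ![z i, z j, z k]

theorem cubeForm_ιMulti (a b : Fin 3 → pPart B r) :
    cubeForm B r (exteriorPower.ιMulti ℂ 3 a) (exteriorPower.ιMulti ℂ 3 b) =
      (Matrix.of fun i j => pForm B r (a i) (b j)).det := by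
  rw [← Matrix.det_transpose]
  simp only [cubeForm, LinearMap.comp_apply, exteriorPower.map_apply_ιMulti,
    exteriorPower.pairingDual_ιMulti_ιMulti]
  rfl

theorem cubeForm_cubicElement (hBsymm : B.IsSymm) (hBinv : B.lieInvariant g)
    (hz : IsOrthonormalBasis B r z) (x x' x'' : pPart B r) :
    B ⁅(x : g), (x' : g)⁆ x'' =
      -2 * cubeForm B r (cubicElement B r z) (exteriorPower.ιMulti ℂ 3 ![x, x', x'']) := by
  have expand : ∀ y : pPart B r, y = ∑ i, pForm B r (z i) y • z i := by
    intro y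
    classical
    have key : ∀ i, pForm B r (z i) y = z.repr y i := by
      intro i
      conv_lhs => rw [← z.sum_repr y]
      simp only [map_sum, map_smul, smul_eq_mul]
      rw [Finset.sum_eq_single i]
      · rw [hz.1 i, mul_one]
      · intro j _ hj
        rw [hz.2 i j hj.symm, mul_zero]
      · simp
    simp only [key]
    exact (z.sum_repr y).symm
  have tri : ∀ a b c : pPart B r,
      ∑ i, ∑ j, ∑ k, B ⁅(z i : g), (z j : g)⁆ (z k) *
        (pForm B r (z i) a * pForm B r (z j) b * pForm B r (z k) c) =
      B ⁅(a : g), (b : g)⁆ c := by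
    intro a b c
    have ha : (a : g) = ∑ i, pForm B r (z i) a • (z i : g) := by
      conv_lhs => rw [expand a]
      simp
    have hb : (b : g) = ∑ i, pForm B r (z i) b • (z i : g) := by
      conv_lhs => rw [expand b]
      simp
    have hc : (c : g) = ∑ i, pForm B r (z i) c • (z i : g) := by
      conv_lhs => rw [expand c]
      simp
    rw [ha, hb, hc]
    simp only [sum_lie, lie_sum, smul_lie, lie_smul, map_sum, map_smul, LinearMap.sum_apply,
      LinearMap.smul_apply, smul_eq_mul]
    rw [Finset.sum_comm]
    rw [Finset.sum_congr rfl fun j _ => Finset.sum_comm, Finset.sum_comm]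
    simp only [Finset.mul_sum]
    refine Finset.sum_congr rfl fun i _ => Finset.sum_congr rfl fun j _ =>
      Finset.sum_congr rfl fun k _ => ?_
    ring
  have skew₁ : ∀ a b c : pPart B r, B ⁅(b : g), (a : g)⁆ c = - B ⁅(a : g), (b : g)⁆ c := by
    intro a b c
    rw [← lie_skew (a : g) (b : g), map_neg, LinearMap.neg_apply, neg_neg]
  have skew₂ : ∀ a b c : pPart B r, B ⁅(a : g), (c : g)⁆ b = - B ⁅(a : g), (b : g)⁆ c := by
    intro a b c
    rw [hBinv (a : g) (c : g) (b : g), hBsymm.eq]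
  have expand_det : cubeForm B r (cubicElement B r z) (exteriorPower.ιMulti ℂ 3 ![x, x', x'']) =
      (-1 / 12 : ℂ) * (B ⁅(x : g), (x' : g)⁆ x'' - B ⁅(x : g), (x'' : g)⁆ x'
        - B ⁅(x' : g), (x : g)⁆ x'' + B ⁅(x'' : g), (x : g)⁆ x'
        + B ⁅(x' : g), (x'' : g)⁆ x - B ⁅(x'' : g), (x' : g)⁆ x) := by
    rw [← tri x x' x'', ← tri x x'' x', ← tri x' x x'', ← tri x'' x x', ← tri x' x'' x,
      ← tri x'' x' x]
    simp only [cubicElement, map_smul, map_sum, LinearMap.smul_apply, LinearMap.sum_apply,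
      cubeForm_ιMulti, smul_eq_mul, Matrix.det_fin_three, ← Finset.sum_sub_distrib,
      ← Finset.sum_add_distrib]
    congr 1
    refine Finset.sum_congr rfl fun i _ => Finset.sum_congr rfl fun j _ =>
      Finset.sum_congr rfl fun k _ => ?_
    simp
    ring
  rw [expand_det, skew₂ x x' x'', skew₁ x x' x'', skew₁ x x'' x', skew₂ x x' x'',
    skew₁ x'' x' x, skew₂ x'' x x', skew₁ x x'' x', skew₂ x x' x'']
  ring

/-- The cubic Dirac operator `□ = ∑ᵢ zᵢ ⊗ zᵢ + 1 ⊗ v` in `U(𝔤) ⊗ C(𝔭)`, for an orthonormal basis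
`z` of `𝔭`. Here `⋀𝔭` and `C(𝔭)` are identified as vector spaces in the usual way. -/
def dirac : UniversalEnvelopingAlgebra ℂ g ⊗[ℂ] Cl B r :=
  (∑ i, UniversalEnvelopingAlgebra.ι ℂ (z i : g) ⊗ₜ[ℂ] CliffordAlgebra.ι (pQuad B r) (z i)) +
    1 ⊗ₜ[ℂ] (CliffordAlgebra.equivExterior (pQuad B r)).symm
      (cubicElement B r z : ExteriorAlgebra ℂ (pPart B r))

end Basis

/-- The left ideal `L = C(𝔭) u`. -/
def leftIdeal (u : Cl B r) : Submodule (Cl B r) (Cl B r) :=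
  Submodule.span (Cl B r) {u}

/-- The subspace `C(𝔞) u` of `L = C(𝔭) u`, for a subspace `𝔞` of `𝔭`. -/
def clSubMul (a : Submodule ℂ (pPart B r)) (u : Cl B r) : Submodule ℂ (leftIdeal B r u) :=
  ((Subalgebra.toSubmodule (clSub B r a)).map (LinearMap.mulRight ℂ u)).comap
    ((leftIdeal B r u).subtype.restrictScalars ℂ)

/-- The action of `A ⊗ C` on `V ⊗ M` given by actions of `A` on `V` and of `C` on `M`. -/
def tensorAction {A C V M : Type*} [Ring A] [Algebra ℂ A] [Ring C] [Algebra ℂ C]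
    [AddCommGroup V] [Module ℂ V] [AddCommGroup M] [Module ℂ M]
    (p : A →ₐ[ℂ] Module.End ℂ V) (q : C →ₐ[ℂ] Module.End ℂ M) :
    A ⊗[ℂ] C →ₐ[ℂ] Module.End ℂ (V ⊗[ℂ] M) :=
  (Module.endTensorEndAlgHom (R := ℂ) (S := ℂ) (A := ℂ)).comp (Algebra.TensorProduct.map p q)

theorem tensorAction_tmul {A C V M : Type*} [Ring A] [Algebra ℂ A] [Ring C] [Algebra ℂ C]
    [AddCommGroup V] [Module ℂ V] [AddCommGroup M] [Module ℂ M]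
    (p : A →ₐ[ℂ] Module.End ℂ V) (q : C →ₐ[ℂ] Module.End ℂ M) (a : A) (c : C) (y : V) (l : M) :
    tensorAction p q (a ⊗ₜ[ℂ] c) (y ⊗ₜ[ℂ] l) = p a y ⊗ₜ[ℂ] q c l :=
  rfl

section Action

variable (V : Type*) [AddCommGroup V] [Module ℂ V] [LieRingModule g V] [LieModule ℂ g V]
  (u : Cl B r)

/-- The action of `U(𝔤) ⊗ C(𝔭)` on `V ⊗ L`, where `U(𝔤)` acts on the `𝔤`-module `V` and `C(𝔭)`
acts on `L = C(𝔭) u` by left multiplication. -/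
def xi : UniversalEnvelopingAlgebra ℂ g ⊗[ℂ] Cl B r →ₐ[ℂ]
    Module.End ℂ (V ⊗[ℂ] leftIdeal B r u) :=
  tensorAction (UniversalEnvelopingAlgebra.lift ℂ (LieModule.toEnd ℂ g V))
    (Algebra.lsmul ℂ ℂ (leftIdeal B r u))

theorem xi_tmul (x : g) (c : Cl B r) (y : V) (l : leftIdeal B r u) :
    xi B r V u (UniversalEnvelopingAlgebra.ι ℂ x ⊗ₜ[ℂ] c) (y ⊗ₜ[ℂ] l) =
      ⁅x, y⁆ ⊗ₜ[ℂ] (c • l) := by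
  simp [xi, tensorAction_tmul]

/-- The subspace `ℂ v ⊗ C(𝔞) u` of `V ⊗ L`, for a subspace `𝔞` of `𝔭`. -/
def cocycleSpace (a : Submodule ℂ (pPart B r)) (v : V) :
    Submodule ℂ (V ⊗[ℂ] leftIdeal B r u) :=
  Submodule.map₂ (TensorProduct.mk ℂ V (leftIdeal B r u)) (Submodule.span ℂ {v})
    (clSubMul B r a u)

end Action

/-! ### Dirac cohomology -/

/-- The cohomology `Ker D / (Ker D ∩ Im D)` of an endomorphism `D`. -/
abbrev Cohomology {W : Type*} [AddCommGroup W] [Module ℂ W] (D : Module.End ℂ W) : Type _ :=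
  LinearMap.ker D ⧸ (LinearMap.range D).submoduleOf (LinearMap.ker D)

/-- The map from cocycles to cohomology classes, on a subspace `E` of `Ker D`. -/
def toCohomology {W : Type*} [AddCommGroup W] [Module ℂ W] (D : Module.End ℂ W)
    {E : Submodule ℂ W} (hE : E ≤ LinearMap.ker D) : E →ₗ[ℂ] Cohomology D :=
  ((LinearMap.range D).submoduleOf (LinearMap.ker D)).mkQ ∘ₗ Submodule.inclusion hE

end CubicDirac

end

/-!
The action of `□` on `V ⊗ L` is compared with two kinds of vacuum vectors. Let `Π` (`posProj`) be
the projection of `𝔤` onto `𝔫` along `𝔥 + 𝔫⁻`, where `𝔫⁻` is the sum of the negative root spaces,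
that is, `nPart` for `-f`. It preserves `𝔯` (`posProj_mem_subalgebra`): on `𝔯` it agrees with a
polynomial in `ad x` for an `x ∈ 𝔥 ∩ 𝔯` with hyperbolic part `f_𝔯`. The adjoint of `Π` is the
projection onto `𝔫⁻`, so both projections also preserve `𝔭`.

The cubic term `v` of `□` acts on vacuum vectors as the restriction of `ρ`: if `𝔫 ∩ 𝔭` annihilates
`l ∈ C(𝔭)` from the left, then `v l = ∑ᵢ ρ((zᵢ)₀) zᵢ l`, where `(z)₀` is the component of `z` in
`𝔥` (`cubic_mul`). This is a normal ordering computation in the Clifford algebra (`cubicSum_mul`),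
which produces the sum `∑ⱼ ([y, Π zⱼ], zⱼ)` over `𝔭`. As `[𝔭, 𝔯] ⊆ 𝔭`, the analogous sum over `𝔯`
vanishes, so the sum is the trace of `ad y ∘ Π` on the whole of `𝔤`, which is `2ρ` on `𝔥` and zero
on `𝔫 + 𝔫⁻` (`trace_ad_mul_posProj`). Applying the reversal of `C(𝔭)` yields the same formula for
right multiplication when `𝔫⁻ ∩ 𝔭` annihilates `l` from the right (`mul_cubic`).

The quadratic term of `□` contributes `λ` in the same way, so `□ (v_λ ⊗ l)` is the action of
`λ + ρ`, restricted to `𝔥 ∩ 𝔭`, hence zero (`xi_dirac_highestWeight_tmul`). Dually, let `φ` be the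
coordinate of `v_λ`, a functional on `V` which vanishes on `𝔫⁻ V`, and let `u⁻` be a product of a
basis of `𝔫⁻ ∩ 𝔭`. Then `y ⊗ l ↦ φ(y) u⁻ l` vanishes on the image of `□` (`pairing_xi_dirac`), and
it maps `v_λ ⊗ c u` to `u⁻ c u`, which is nonzero for each nonzero `c ∈ C(𝔥 ∩ 𝔭)`
(`eq_zero_of_oppositeProd_mul_eq_zero`). So no nonzero element of `ℂ v_λ ⊗ C(𝔥 ∩ 𝔭) u` is in the
image of `□`.
-/

noncomputable section

namespace CubicDirac

/-! ### Clifford algebras: contractions, dimension, products of isotropic vectors -/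

section CliffordGeneral

open CliffordAlgebra

variable {M : Type*} [AddCommGroup M] [Module ℂ M]

/-- A contraction is a skew derivation, and it kills the subalgebra generated by vectors in its
kernel. -/
theorem contractLeft_mul_of_mem_adjoin {Q : QuadraticForm ℂ M} {A : Set M} {d : Module.Dual ℂ M}
    (hd : ∀ a ∈ A, d a = 0) {c : CliffordAlgebra Q} (hc : c ∈ Algebra.adjoin ℂ (ι Q '' A))
    (y : CliffordAlgebra Q) : contractLeft d (c * y) = involute c * contractLeft d y := by
  induction hc using Algebra.adjoin_induction generalizing y with
  | mem x hx =>
    obtain ⟨a, ha, rfl⟩ := hx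
    rw [contractLeft_ι_mul, hd a ha, involute_ι]
    simp
  | algebraMap r => rw [contractLeft_algebraMap_mul, AlgHom.commutes]
  | add x y _ _ hx hy => simp only [add_mul, map_add, hx, hy]
  | mul x y _ _ hx hy => rw [mul_assoc, hx, hy, map_mul, mul_assoc]

theorem involute_mem_adjoin {Q : QuadraticForm ℂ M} {A : Set M} {c : CliffordAlgebra Q}
    (hc : c ∈ Algebra.adjoin ℂ (ι Q '' A)) : involute c ∈ Algebra.adjoin ℂ (ι Q '' A) := by
  induction hc using Algebra.adjoin_induction with
  | mem x hx =>
    obtain ⟨a, ha, rfl⟩ := hx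
    rw [involute_ι]
    exact neg_mem (Algebra.subset_adjoin ⟨a, ha, rfl⟩)
  | algebraMap r => rw [AlgHom.commutes]; exact Subalgebra.algebraMap_mem _ r
  | add x y _ _ hx hy => rw [map_add]; exact add_mem hx hy
  | mul x y _ _ hx hy => rw [map_mul]; exact mul_mem hx hy

theorem reverse_mem_adjoin {Q : QuadraticForm ℂ M} {A : Set M} {c : CliffordAlgebra Q}
    (hc : c ∈ Algebra.adjoin ℂ (ι Q '' A)) : reverse c ∈ Algebra.adjoin ℂ (ι Q '' A) := by
  induction hc using Algebra.adjoin_induction with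
  | mem x hx =>
    obtain ⟨a, ha, rfl⟩ := hx
    rw [reverse_ι]
    exact Algebra.subset_adjoin ⟨a, ha, rfl⟩
  | algebraMap r => rw [reverse.commutes]; exact Subalgebra.algebraMap_mem _ r
  | add x y _ _ hx hy => rw [map_add]; exact add_mem hx hy
  | mul x y _ _ hx hy => rw [reverse.map_mul]; exact mul_mem hy hx

/-- Contracting successively with the dual vectors `d i` recovers `c`, up to sign, from
`c * e₁ ⋯ eₙ`. -/
theorem eq_zero_of_mul_prod_eq_zero {Q : QuadraticForm ℂ M} {A : Set M} {n : ℕ} (e : Fin n → M)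
    (d : Fin n → Module.Dual ℂ M) (hde : ∀ i j, d i (e j) = if i = j then 1 else 0)
    (hdA : ∀ i, ∀ a ∈ A, d i a = 0) {c : CliffordAlgebra Q}
    (hc : c ∈ Algebra.adjoin ℂ (ι Q '' A))
    (h0 : c * (List.ofFn fun i => ι Q (e i)).prod = 0) : c = 0 := by
  induction n generalizing c with
  | zero => simpa using h0
  | succ n ih =>
    have hinv := involute_mem_adjoin hc
    suffices h : involute c = 0 from involute_involutive.injective (by rw [h, map_zero])
    refine ih (fun i => e i.succ) (fun i => d i.succ) (fun i j => by simp [hde])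
      (fun i => hdA _) hinv ?_
    have h1 := congrArg (contractLeft (d 0)) h0
    have hkill : contractLeft (d 0) (List.ofFn fun i : Fin n => ι Q (e i.succ)).prod = 0 := by
      have hmem : (List.ofFn fun i : Fin n => ι Q (e i.succ)).prod ∈
          Algebra.adjoin ℂ (ι Q '' Set.range fun i : Fin n => e i.succ) := by
        refine Subalgebra.list_prod_mem _ fun x hx => ?_
        obtain ⟨i, rfl⟩ := (List.mem_ofFn' _ _).1 hx
        exact Algebra.subset_adjoin ⟨_, ⟨i, rfl⟩, rfl⟩
      have := contractLeft_mul_of_mem_adjoin (d := d 0)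
        (by rintro _ ⟨i, rfl⟩; simp [hde, (Fin.succ_ne_zero i).symm]) hmem 1
      simpa using this
    rw [map_zero, contractLeft_mul_of_mem_adjoin (hdA 0) hc, List.ofFn_succ, List.prod_cons,
      contractLeft_ι_mul, hkill, hde] at h1
    simpa using h1

/-- The product of vectors which span an isotropic subspace is annihilated by that subspace. -/
theorem ι_mul_prod_eq_zero {Q : QuadraticForm ℂ M} {n : ℕ} (e : Fin n → M)
    (hQ : ∀ x ∈ Submodule.span ℂ (Set.range e), Q x = 0) {y : M}
    (hy : y ∈ Submodule.span ℂ (Set.range e)) :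
    ι Q y * (List.ofFn fun i => ι Q (e i)).prod = 0 := by
  have anti : ∀ x ∈ Submodule.span ℂ (Set.range e), ∀ y ∈ Submodule.span ℂ (Set.range e),
      ι Q x * ι Q y = - (ι Q y * ι Q x) := by
    intro x hx y hy
    rw [eq_neg_iff_add_eq_zero, ι_mul_ι_add_swap, QuadraticMap.polar, hQ _ (add_mem hx hy),
      hQ x hx, hQ y hy]
    simp
  induction hy using Submodule.span_induction with
  | zero => simp
  | add x y _ _ hx hy => rw [map_add, add_mul, hx, hy, add_zero]
  | smul c x _ hx => rw [map_smul, smul_mul_assoc, hx, smul_zero]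
  | mem x hx =>
    obtain ⟨i, rfl⟩ := hx
    induction n with
    | zero => exact i.elim0
    | succ n ih =>
      have hle : Submodule.span ℂ (Set.range fun i : Fin n => e i.succ) ≤
          Submodule.span ℂ (Set.range e) :=
        Submodule.span_mono (by rintro _ ⟨i, rfl⟩; exact ⟨_, rfl⟩)
      rw [List.ofFn_succ, List.prod_cons, ← mul_assoc]
      refine Fin.cases ?_ (fun i => ?_) i
      · rw [ι_sq_scalar, hQ _ (Submodule.subset_span ⟨0, rfl⟩), map_zero, zero_mul]
      · rw [anti _ (Submodule.subset_span ⟨_, rfl⟩) _ (Submodule.subset_span ⟨_, rfl⟩), neg_mul,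
          mul_assoc, ih (fun i => e i.succ) (fun x hx => hQ x (hle hx))
            (fun x hx y hy => anti x (hle hx) y (hle hy)) i, mul_zero, neg_zero]

theorem ι_mul_eq_involute_mul {Q : QuadraticForm ℂ M} {A : Set M} {e : M}
    (he : ∀ a ∈ A, QuadraticMap.polar Q e a = 0) {c : CliffordAlgebra Q}
    (hc : c ∈ Algebra.adjoin ℂ (ι Q '' A)) : ι Q e * c = involute c * ι Q e := by
  induction hc using Algebra.adjoin_induction with
  | mem x hx =>
    obtain ⟨a, ha, rfl⟩ := hx
    rw [involute_ι, neg_mul, eq_neg_iff_add_eq_zero, ι_mul_ι_add_swap, he a ha, map_zero]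
  | algebraMap r => rw [AlgHom.commutes, Algebra.commutes]
  | add x y _ _ hx hy => rw [map_add, mul_add, add_mul, hx, hy]
  | mul x y _ _ hx hy => rw [map_mul, ← mul_assoc, hx, mul_assoc, hy, mul_assoc]

theorem contractLeft_map {N : Type*} [AddCommGroup N] [Module ℂ N] {Q : QuadraticForm ℂ M}
    {Q' : QuadraticForm ℂ N} (f : Q' →qᵢ Q) (d : Module.Dual ℂ M) (x : CliffordAlgebra Q') :
    contractLeft d (map f x) = map f (contractLeft (d ∘ₗ f.toLinearMap) x) := by
  induction x using CliffordAlgebra.left_induction with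
  | algebraMap r => simp
  | add x y hx hy => simp only [map_add, hx, hy]
  | ι_mul x m hx =>
    rw [map_mul, map_apply_ι, contractLeft_ι_mul, hx, contractLeft_ι_mul]
    simp

/-- The identification of Clifford algebras of different quadratic forms is natural. -/
theorem changeForm_map {N : Type*} [AddCommGroup N] [Module ℂ N] {Q₁ Q₂ : QuadraticForm ℂ M}
    {Q₁' Q₂' : QuadraticForm ℂ N} (f : Q₁' →qᵢ Q₁) (g : Q₂' →qᵢ Q₂)
    (hfg : f.toLinearMap = g.toLinearMap) {β : LinearMap.BilinForm ℂ M}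
    {β' : LinearMap.BilinForm ℂ N} (hβ : β.toQuadraticMap = Q₂ - Q₁)
    (hβ' : β'.toQuadraticMap = Q₂' - Q₁') (hββ' : ∀ x y, β (f x) (f y) = β' x y)
    (x : CliffordAlgebra Q₁') : changeForm hβ (map f x) = map g (changeForm hβ' x) := by
  induction x using CliffordAlgebra.left_induction with
  | algebraMap r => simp
  | add x y hx hy => simp only [map_add, hx, hy]
  | ι_mul x m hx =>
    have hm : f m = g m := LinearMap.congr_fun hfg m
    rw [map_mul, map_apply_ι, changeForm_ι_mul, hx, changeForm_ι_mul, contractLeft_map, map_sub,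
      map_mul, map_apply_ι, hm]
    congr 4
    ext y
    have hy : f y = g y := LinearMap.congr_fun hfg y
    rw [← hββ' m y, hm, hy]
    rfl

/-- The subalgebra generated by `A` is the image of the Clifford algebra of `A`, on which the map is
injective because it is so for exterior algebras. -/
theorem finrank_adjoin (Q : QuadraticForm ℂ M) (A : Submodule ℂ M) [FiniteDimensional ℂ A] :
    Module.finrank ℂ (Algebra.adjoin ℂ (ι Q '' (A : Set M))) = 2 ^ Module.finrank ℂ A := by
  let f : (Q.comp A.subtype) →qᵢ Q := ⟨A.subtype, fun _ => rfl⟩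
  let g : (0 : QuadraticForm ℂ A) →qᵢ (0 : QuadraticForm ℂ M) := ⟨A.subtype, fun _ => rfl⟩
  obtain ⟨k, hk⟩ := A.subtype.exists_leftInverse_of_injective A.ker_subtype
  let k' : (0 : QuadraticForm ℂ M) →qᵢ (0 : QuadraticForm ℂ A) := ⟨k, fun _ => rfl⟩
  have hg : Function.Injective (map g) := by
    refine Function.LeftInverse.injective (g := map k') fun x => ?_
    rw [← AlgHom.comp_apply, map_comp_map]
    have : k'.comp g = QuadraticMap.Isometry.id _ := by
      ext y
      exact congrArg Subtype.val (LinearMap.congr_fun hk y)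
    rw [this, map_id]; rfl
  have hf : Function.Injective (map f) := by
    intro x y hxy
    have h1 := congrArg (equivExterior Q) hxy
    have key : ∀ x, equivExterior Q (map f x) = map g (equivExterior (Q.comp A.subtype) x) := by
      intro x
      refine changeForm_map f g rfl changeForm.associated_neg_proof
        changeForm.associated_neg_proof (fun x y => ?_) x
      simp [QuadraticMap.associated_apply, f]; rfl
    rw [key, key] at h1
    exact (equivExterior _).injective (hg h1)
  have hrange : (map f).range = Algebra.adjoin ℂ (ι Q '' (A : Set M)) := by
    rw [← Algebra.map_top, ← adjoin_range_ι, AlgHom.map_adjoin]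
    congr 1
    ext x
    constructor
    · rintro ⟨_, ⟨a, rfl⟩, rfl⟩
      exact ⟨a, a.2, (map_apply_ι f a).symm⟩
    · rintro ⟨a, ha, rfl⟩
      exact ⟨_, ⟨⟨a, ha⟩, rfl⟩, map_apply_ι f ⟨a, ha⟩⟩
  rw [← hrange]
  have e1 : CliffordAlgebra (Q.comp A.subtype) ≃ₗ[ℂ] (map f).range :=
    (AlgEquiv.ofInjective (map f) hf).toLinearEquiv
  rw [← e1.finrank_eq, (equivExterior (Q.comp A.subtype)).finrank_eq,
    Module.finrank_eq_card_basis (Module.finBasis ℂ A).ExteriorAlgebra]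
  simp

end CliffordGeneral

/-! ### Normal ordering of cubic elements of a Clifford algebra -/

section CubicElement

open CliffordAlgebra

variable {M : Type*} [AddCommGroup M] [Module ℂ M] {b : LinearMap.BilinForm ℂ M}
  {κ : Type*} [Fintype κ] {z : κ → M}

/-- The tensor `∑ zᵢ ⊗ zᵢ` of an orthonormal basis is invariant under moving an operator from one
factor to the other, where it becomes its adjoint. -/
theorem sum_dual_swap {X : Type*} [AddCommGroup X] [Module ℂ X] (hb : b.IsSymm)
    (hz : ∀ y, ∑ i, b (z i) y • z i = y) {A A' : Module.End ℂ M}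
    (hA : ∀ x y, b (A x) y = b x (A' y)) (F : M → M → X)
    (h₁ : ∀ y, IsLinearMap ℂ fun x => F x y) (h₂ : ∀ x, IsLinearMap ℂ (F x)) :
    ∑ i, F (A (z i)) (z i) = ∑ i, F (z i) (A' (z i)) := by
  have e₁ : ∀ i, F (A (z i)) (z i) = ∑ j, b (z j) (A (z i)) • F (z j) (z i) := by
    intro i
    conv_lhs => rw [← hz (A (z i))]
    change (h₁ (z i)).mk' _ _ = _
    simp
  have e₂ : ∀ i, F (z i) (A' (z i)) = ∑ j, b (z j) (A' (z i)) • F (z i) (z j) := by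
    intro i
    conv_lhs => rw [← hz (A' (z i))]
    change (h₂ (z i)).mk' _ _ = _
    simp
  simp only [e₁, e₂]
  rw [Finset.sum_comm]
  refine Finset.sum_congr rfl fun i _ => Finset.sum_congr rfl fun j _ => ?_
  rw [← hA, hb.eq]

theorem ι_mul_ι_add_swap_toQuadraticMap (hb : b.IsSymm) (x y : M) :
    ι b.toQuadraticMap x * ι b.toQuadraticMap y + ι b.toQuadraticMap y * ι b.toQuadraticMap x =
      algebraMap ℂ _ (2 * b x y) := by
  rw [ι_mul_ι_add_swap]
  congr 1
  simp only [QuadraticMap.polar, LinearMap.BilinMap.toQuadraticMap_apply, map_add,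
    LinearMap.add_apply]
  rw [hb.eq y x]
  ring

variable (b z) in
/-- The quadratic element `∑ T(w, zⱼ, zₖ) zⱼ zₖ` of the Clifford algebra, for a trilinear form
`T`, as a linear function of `w`. -/
def quadraticElement (T : M →ₗ[ℂ] M →ₗ[ℂ] M →ₗ[ℂ] ℂ) :
    M →ₗ[ℂ] CliffordAlgebra b.toQuadraticMap where
  toFun w := ∑ j, ∑ k, T w (z j) (z k) • (ι b.toQuadraticMap (z j) * ι b.toQuadraticMap (z k))
  map_add' x y := by simp [add_smul, Finset.sum_add_distrib]
  map_smul' c x := by simp [mul_smul, Finset.smul_sum]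

variable {T : M →ₗ[ℂ] M →ₗ[ℂ] M →ₗ[ℂ] ℂ} {P N : Module.End ℂ M}

/-- The range of `P` annihilates `l`, and `N` is the adjoint of `P`. For the elements `w` considered
here, only the contractions of `zⱼ` with `zₖ` survive when the annihilating factors are moved to the
right. -/
theorem quadraticElement_mul (hb : b.IsSymm) (hz : ∀ y, ∑ i, b (z i) y • z i = y)
    (hT₂ : ∀ x y w, T x w y = -T x y w)
    (hPN : ∀ x y, b (P x) y = b x (N y)) (hNP : ∀ x, N (P x) = 0)
    {l : CliffordAlgebra b.toQuadraticMap} (hl : ∀ x, ι b.toQuadraticMap (P x) * l = 0)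
    {w : M} (hw : ∀ x y, T w (x - N x) (y - N y) = 0) :
    quadraticElement b z T w * l = (-2 * ∑ j, T w (P (z j)) (z j)) • l := by
  -- `P (z k)` kills `l`, so `z k` may be replaced by its component in the kernel of `P`
  have s₁ : ∀ j, ∑ k, T w (z j) (z k) •
        (ι b.toQuadraticMap (z j) * (ι b.toQuadraticMap (z k) * l)) =
      ∑ k, T w (N (z j)) (z k - N (z k)) •
        (ι b.toQuadraticMap (z j) * (ι b.toQuadraticMap (z k) * l)) := by
    intro j
    have h := sum_dual_swap hb hz (A := 1 - N) (A' := 1 - P)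
      (fun x y => by
        simp only [LinearMap.sub_apply, Module.End.one_apply, map_sub]
        rw [hb.eq (N x) y, ← hPN, hb.eq (P y) x])
      (fun x y => T w (z j) x • (ι b.toQuadraticMap (z j) * (ι b.toQuadraticMap y * l)))
      (fun y => ⟨fun _ _ => by simp [add_smul], fun _ _ => by simp [mul_smul]⟩)
      (fun x => ⟨fun _ _ => by simp [mul_add, add_mul], fun _ _ => by
        simp only [map_smul, smul_mul_assoc, mul_smul_comm]
        rw [smul_comm]⟩)
    simp only [LinearMap.sub_apply, Module.End.one_apply, map_sub (ι b.toQuadraticMap), sub_mul,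
      hl, sub_zero] at h
    rw [← h]
    refine Finset.sum_congr rfl fun k _ => ?_
    have := hw (z j) (z k)
    rw [map_sub (T w), LinearMap.sub_apply, sub_eq_zero] at this
    rw [this]
  -- now the first factor lies in the range of `P`: only its contraction with the second survives
  have s₂ : ∀ k, ∑ j, T w (N (z j)) (z k - N (z k)) •
        (ι b.toQuadraticMap (z j) * (ι b.toQuadraticMap (z k) * l)) =
      (2 * T w (N (z k)) (z k - N (z k))) • l := by
    intro k
    have h := sum_dual_swap hb hz (A := N) (A' := P)
      (fun x y => by rw [hb.eq, ← hPN, hb.eq])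
      (fun x y => T w x (z k - N (z k)) •
        (ι b.toQuadraticMap y * (ι b.toQuadraticMap (z k) * l)))
      (fun y => ⟨fun _ _ => by simp [add_smul], fun _ _ => by simp [mul_smul]⟩)
      (fun x => ⟨fun _ _ => by simp [add_mul], fun _ _ => by
        simp only [map_smul, smul_mul_assoc]
        rw [smul_comm]⟩)
    rw [h]
    have h' : ∀ j, ι b.toQuadraticMap (P (z j)) * (ι b.toQuadraticMap (z k) * l) =
        (2 * b (z j) (N (z k))) • l := by
      intro j
      rw [← mul_assoc, eq_sub_of_add_eq (ι_mul_ι_add_swap_toQuadraticMap hb _ _), sub_mul,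
        mul_assoc, hl, mul_zero, sub_zero, hPN, Algebra.smul_def]
    simp only [h', smul_smul]
    rw [← Finset.sum_smul]
    congr 1
    conv_rhs => rw [← hz (N (z k))]
    simp only [map_sum, map_smul, LinearMap.sum_apply, LinearMap.smul_apply, smul_eq_mul,
      Finset.mul_sum]
    have e := hz (N (z k))
    rw [e]
    exact Finset.sum_congr rfl fun j _ => by ring
  have s₃ := sum_dual_swap hb hz (A := N) (A' := P)
      (fun x y => by rw [hb.eq, ← hPN, hb.eq])
      (fun x y => T w x (y - N y))
      (fun y => ⟨fun _ _ => by simp, fun _ _ => by simp⟩)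
      (fun x => ⟨fun _ _ => by simp; ring, fun _ _ => by simp; ring⟩)
  simp only [hNP, sub_zero] at s₃
  change (∑ j, ∑ k, T w (z j) (z k) • (ι b.toQuadraticMap (z j) * ι b.toQuadraticMap (z k))) * l
    = _
  simp only [Finset.sum_mul, smul_mul_assoc, mul_assoc]
  rw [Finset.sum_congr rfl fun j _ => s₁ j, Finset.sum_comm, Finset.sum_congr rfl fun j _ => s₂ j,
    ← Finset.sum_smul, ← Finset.mul_sum, s₃]
  congr 1
  simp only [hT₂ w (P _), Finset.sum_neg_distrib]
  ring

theorem ι_mul_quadraticElement (hb : b.IsSymm) (hz : ∀ y, ∑ i, b (z i) y • z i = y)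
    (hT₂ : ∀ x y w, T x w y = -T x y w) (e w : M) :
    ι b.toQuadraticMap e * quadraticElement b z T w =
      quadraticElement b z T w * ι b.toQuadraticMap e +
        (4 : ℂ) • ∑ k, T w e (z k) • ι b.toQuadraticMap (z k) := by
  have comm : ∀ x y : M, ι b.toQuadraticMap e * (ι b.toQuadraticMap x * ι b.toQuadraticMap y) =
      ι b.toQuadraticMap x * ι b.toQuadraticMap y * ι b.toQuadraticMap e +
        ((2 * b x e) • ι b.toQuadraticMap y - (2 * b y e) • ι b.toQuadraticMap x) := by
    intro x y
    have h₁ := ι_mul_ι_add_swap_toQuadraticMap hb e x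
    have h₂ := ι_mul_ι_add_swap_toQuadraticMap hb e y
    rw [hb.eq] at h₁ h₂
    rw [← mul_assoc, eq_sub_of_add_eq h₁, sub_mul, mul_assoc, eq_sub_of_add_eq h₂, mul_sub,
      Algebra.smul_def, Algebra.smul_def, ← Algebra.commutes (2 * b y e), mul_assoc]
    abel
  have expand : ∀ F : M →ₗ[ℂ] ℂ, ∑ i, F (z i) * b (z i) e = F e := by
    intro F
    conv_rhs => rw [← hz e]
    simp [mul_comm]
  have h₁ : ∑ j, ∑ k, T w (z j) (z k) • ((2 * b (z j) e) • ι b.toQuadraticMap (z k)) =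
      (2 : ℂ) • ∑ k, T w e (z k) • ι b.toQuadraticMap (z k) := by
    rw [Finset.sum_comm, Finset.smul_sum]
    refine Finset.sum_congr rfl fun k _ => ?_
    have := expand ((T w).flip (z k))
    simp only [LinearMap.flip_apply] at this
    rw [← this, Finset.sum_smul, Finset.smul_sum]
    refine Finset.sum_congr rfl fun j _ => ?_
    simp only [smul_smul]
    congr 1
    ring
  have h₂ : ∑ j, ∑ k, T w (z j) (z k) • ((2 * b (z k) e) • ι b.toQuadraticMap (z j)) =
      -((2 : ℂ) • ∑ k, T w e (z k) • ι b.toQuadraticMap (z k)) := by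
    rw [Finset.smul_sum, ← Finset.sum_neg_distrib]
    refine Finset.sum_congr rfl fun j _ => ?_
    have := expand (T w (z j))
    rw [hT₂] at this
    rw [← smul_neg, ← neg_smul, ← this]
    rw [Finset.sum_smul, Finset.smul_sum]
    refine Finset.sum_congr rfl fun k _ => ?_
    simp only [smul_smul]
    congr 1
    ring
  change ι b.toQuadraticMap e *
      (∑ j, ∑ k, T w (z j) (z k) • (ι b.toQuadraticMap (z j) * ι b.toQuadraticMap (z k))) =
    (∑ j, ∑ k, T w (z j) (z k) • (ι b.toQuadraticMap (z j) * ι b.toQuadraticMap (z k))) *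
      ι b.toQuadraticMap e + _
  simp only [Finset.mul_sum, Finset.sum_mul, mul_smul_comm, comm, smul_add, smul_sub,
    Finset.sum_add_distrib, Finset.sum_sub_distrib, smul_mul_assoc]
  rw [h₁, h₂]
  congr 1
  rw [sub_neg_eq_add, ← add_smul]
  norm_num

/-- Normal ordering of a cubic element on a vector `l` which the range of `P` annihilates. The
coefficient `-6` is `-2 - 4`: the part of `∑ zᵢ ⊗ zᵢ` with first factor outside the range of `P`
contributes `-2` by `quadraticElement_mul`, and moving the range of `P` past the quadratic element
contributes `-4`. -/
theorem cubicSum_mul {Q : QuadraticForm ℂ M} (hQ : Q = b.toQuadraticMap)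
    (hb : b.IsSymm) (hz : ∀ y, ∑ i, b (z i) y • z i = y)
    (hT₁ : ∀ x y w, T y x w = -T x y w) (hT₂ : ∀ x y w, T x w y = -T x y w)
    (hPN : ∀ x y, b (P x) y = b x (N y)) (hNP : ∀ x, N (P x) = 0)
    (hT : ∀ x y w, T (x - N x) (y - N y) (w - N w) = 0)
    {l : CliffordAlgebra Q} (hl : ∀ x, ι Q (P x) * l = 0) :
    (∑ i, ∑ j, ∑ k, T (z i) (z j) (z k) • (ι Q (z i) *
        (ι Q (z j) * ι Q (z k)))) * l =
      (-6 : ℂ) • ∑ i, (∑ j, T (z i - N (z i)) (P (z j)) (z j)) • (ι Q (z i) * l) := by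
  subst hQ
  have h₀ : (∑ i, ∑ j, ∑ k, T (z i) (z j) (z k) • (ι b.toQuadraticMap (z i) *
        (ι b.toQuadraticMap (z j) * ι b.toQuadraticMap (z k)))) * l =
      ∑ i, ι b.toQuadraticMap (z i) * (quadraticElement b z T (z i) * l) := by
    rw [Finset.sum_mul]
    refine Finset.sum_congr rfl fun i _ => ?_
    change _ = ι b.toQuadraticMap (z i) * ((∑ j, ∑ k, T (z i) (z j) (z k) •
      (ι b.toQuadraticMap (z j) * ι b.toQuadraticMap (z k))) * l)
    rw [← mul_assoc]
    simp only [Finset.mul_sum, mul_smul_comm]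
  have h₁ : ∀ i, ι b.toQuadraticMap (z i) * (quadraticElement b z T (z i) * l) =
      (-2 : ℂ) • (∑ j, T (z i - N (z i)) (P (z j)) (z j)) • (ι b.toQuadraticMap (z i) * l) +
        ι b.toQuadraticMap (z i) * (quadraticElement b z T (N (z i)) * l) := by
    intro i
    have := quadraticElement_mul hb hz hT₂ hPN hNP hl (hT (z i))
    rw [map_sub, sub_mul, sub_eq_iff_eq_add] at this
    rw [this, mul_add, mul_smul_comm, smul_smul]
  have h₂ := sum_dual_swap hb hz (A := N) (A' := P)
      (fun x y => by rw [hb.eq, ← hPN, hb.eq])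
      (fun x y => ι b.toQuadraticMap y * (quadraticElement b z T x * l))
      (fun y => ⟨fun _ _ => by simp [mul_add, add_mul], fun _ _ => by simp⟩)
      (fun x => ⟨fun _ _ => by simp [add_mul], fun _ _ => by simp⟩)
  -- the component of the trace functional on the range of `N` pairs with the range of `P`,
  -- which kills `l`
  have h₃ : ∑ i, (∑ j, T (N (z i)) (P (z j)) (z j)) • (ι b.toQuadraticMap (z i) * l) = 0 := by
    have := sum_dual_swap hb hz (A := N) (A' := P)
      (fun x y => by rw [hb.eq, ← hPN, hb.eq])
      (fun x y => (∑ j, T x (P (z j)) (z j)) • (ι b.toQuadraticMap y * l))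
      (fun y => ⟨fun _ _ => by simp [add_smul, Finset.sum_add_distrib],
        fun _ _ => by simp [mul_smul, ← Finset.mul_sum]⟩)
      (fun x => ⟨fun _ _ => by simp [add_mul], fun _ _ => by
        simp only [map_smul, smul_mul_assoc]
        rw [smul_comm]⟩)
    rw [this]
    simp [hl]
  have h₄ : ∀ i, ι b.toQuadraticMap (P (z i)) * (quadraticElement b z T (z i) * l) =
      (4 : ℂ) • ∑ k, T (z i) (P (z i)) (z k) • (ι b.toQuadraticMap (z k) * l) := by
    intro i
    rw [← mul_assoc, ι_mul_quadraticElement hb hz hT₂, add_mul, mul_assoc, hl, mul_zero, zero_add,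
      smul_mul_assoc, Finset.sum_mul]
    simp only [smul_mul_assoc]
  have h₅ : ∑ i, ∑ k, T (z i) (P (z i)) (z k) • (ι b.toQuadraticMap (z k) * l) =
      -∑ i, (∑ j, T (z i - N (z i)) (P (z j)) (z j)) • (ι b.toQuadraticMap (z i) * l) := by
    simp only [map_sub, LinearMap.sub_apply, Finset.sum_sub_distrib, sub_smul]
    rw [h₃, sub_zero, Finset.sum_comm, ← Finset.sum_neg_distrib]
    refine Finset.sum_congr rfl fun k _ => ?_
    rw [← Finset.sum_smul, ← neg_smul, ← Finset.sum_neg_distrib]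
    congr 1
    refine Finset.sum_congr rfl fun i _ => ?_
    rw [hT₂, hT₁, hT₂, neg_neg]
  rw [h₀, Finset.sum_congr rfl fun i _ => h₁ i, Finset.sum_add_distrib, h₂,
    Finset.sum_congr rfl fun i _ => h₄ i, ← Finset.smul_sum, ← Finset.smul_sum, h₅, smul_neg,
    ← sub_eq_add_neg, ← sub_smul]
  norm_num

/-- The mirror image of `cubicSum_mul`: the reversal fixes vectors, negates the cubic element and
exchanges the roles of `P` and `N`, which negates the trace functional. -/
theorem mul_cubicSum {Q : QuadraticForm ℂ M} (hQ : Q = b.toQuadraticMap)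
    (hb : b.IsSymm) (hz : ∀ y, ∑ i, b (z i) y • z i = y)
    (hT₁ : ∀ x y w, T y x w = -T x y w) (hT₂ : ∀ x y w, T x w y = -T x y w)
    (hPN : ∀ x y, b (P x) y = b x (N y)) (hPN0 : ∀ x, P (N x) = 0)
    (hT : ∀ x y w, T (x - P x) (y - P y) (w - P w) = 0)
    {l : CliffordAlgebra Q} (hl : ∀ x, l * ι Q (N x) = 0) :
    l * (∑ i, ∑ j, ∑ k, T (z i) (z j) (z k) • (ι Q (z i) *
        (ι Q (z j) * ι Q (z k)))) =
      (-6 : ℂ) • ∑ i, (∑ j, T (z i - P (z i)) (P (z j)) (z j)) •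
        (l * ι Q (z i)) := by
  subst hQ
  have hNP' : ∀ x y, b (N x) y = b x (P y) := fun x y => by rw [hb.eq, ← hPN, hb.eq]
  have h := cubicSum_mul (l := reverse l) rfl hb hz hT₁ hT₂ hNP' hPN0 hT (fun x => by
    rw [← reverse_ι (Q := b.toQuadraticMap) (N x), ← reverse.map_mul, hl, map_zero])
  have h' := congrArg reverse h
  rw [reverse.map_mul, reverse_reverse] at h'
  have hrev : reverse (∑ i, ∑ j, ∑ k, T (z i) (z j) (z k) • (ι b.toQuadraticMap (z i) *
        (ι b.toQuadraticMap (z j) * ι b.toQuadraticMap (z k)))) =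
      -∑ i, ∑ j, ∑ k, T (z i) (z j) (z k) • (ι b.toQuadraticMap (z i) *
        (ι b.toQuadraticMap (z j) * ι b.toQuadraticMap (z k))) := by
    simp only [map_sum, map_smul, reverse.map_mul, reverse_ι, mul_assoc]
    rw [Finset.sum_congr rfl fun i _ => Finset.sum_comm, Finset.sum_comm,
      Finset.sum_congr rfl fun i _ => Finset.sum_comm]
    simp only [← Finset.sum_neg_distrib, ← neg_smul]
    refine Finset.sum_congr rfl fun i _ => Finset.sum_congr rfl fun j _ =>
      Finset.sum_congr rfl fun k _ => ?_
    rw [hT₁, hT₂, hT₁, neg_neg]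
  rw [hrev, mul_neg, neg_eq_iff_eq_neg] at h'
  rw [h']
  simp only [map_smul, map_sum, reverse.map_mul, reverse_reverse, reverse_ι]
  rw [← smul_neg, ← Finset.sum_neg_distrib]
  congr 1
  refine Finset.sum_congr rfl fun i _ => ?_
  rw [← neg_smul, ← Finset.sum_neg_distrib]
  congr 1
  have := sum_dual_swap hb hz hNP' (fun x y => T (z i - P (z i)) x y)
      (fun y => ⟨fun _ _ => by rw [map_add]; rfl, fun _ _ => by rw [map_smul]; rfl⟩)
      (fun x => ⟨fun _ _ => by rw [map_add], fun _ _ => by rw [map_smul]⟩)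
  rw [Finset.sum_neg_distrib, this, ← Finset.sum_neg_distrib]
  exact Finset.sum_congr rfl fun j _ => by rw [hT₂, neg_neg]

/-- For orthogonal vectors the exterior product corresponds to the Clifford product. -/
theorem equivExterior_symm_ιMulti {x y w : M} (hxy : b x y = 0) (hxw : b x w = 0) (hyw : b y w = 0)
    (hb : b.IsSymm) :
    (equivExterior b.toQuadraticMap).symm
        (exteriorPower.ιMulti ℂ 3 ![x, y, w] : ExteriorAlgebra ℂ M) =
      ι b.toQuadraticMap x * (ι b.toQuadraticMap y * ι b.toQuadraticMap w) := by
  rw [LinearEquiv.symm_apply_eq]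
  have hass : ∀ p q, b p q = 0 →
      QuadraticMap.associated (R := ℂ) (-b.toQuadraticMap) p q = 0 := by
    intro p q hpq
    simp [QuadraticMap.associated_apply, hpq, hb.eq q p]
  change _ = changeForm changeForm.associated_neg_proof _
  rw [changeForm_ι_mul, changeForm_ι_mul_ι, hass _ _ hyw, map_zero, sub_zero, contractLeft_ι_mul,
    contractLeft_ι, hass _ _ hxy, hass _ _ hxw]
  simp [ExteriorAlgebra.ιMulti_apply]

end CubicElement

/-! ### Operators which are scalar on root spaces -/

section DiagonalOperators

variable {g : Type*} [LieRing g] [LieAlgebra ℂ g] [FiniteDimensional ℂ g]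
  (h : LieSubalgebra ℂ g) [h.IsCartanSubalgebra]

/-- The index set of `weightBasis`. -/
abbrev WeightIndex : Type _ :=
  Σ α : LieModule.Weight ℂ h g, Fin (Module.finrank ℂ (LieAlgebra.rootSpace h α).toSubmodule)

open scoped Classical in
theorem isInternal_rootSpace : DirectSum.IsInternal
    fun α : LieModule.Weight ℂ h g => (LieAlgebra.rootSpace h α).toSubmodule := by
  rw [DirectSum.isInternal_submodule_iff_iSupIndep_and_iSup_eq_top]
  refine ⟨LieSubmodule.iSupIndep_toSubmodule.2 (LieModule.iSupIndep_genWeightSpace' ℂ h g), ?_⟩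
  rw [← LieSubmodule.iSup_toSubmodule, LieModule.iSup_genWeightSpace_eq_top',
    LieSubmodule.top_toSubmodule]

open scoped Classical in
/-- A basis of `g` of weight vectors for the Cartan subalgebra `h`. -/
def weightBasis : Module.Basis (WeightIndex h) ℂ g :=
  (isInternal_rootSpace h).collectedBasis fun _ => Module.finBasis ℂ _

open scoped Classical in
theorem weightBasis_mem (i : WeightIndex h) :
    weightBasis h i ∈ LieAlgebra.rootSpace h i.1 :=
  (isInternal_rootSpace h).collectedBasis_mem _ i

/-- The operator on `g` which acts on the root space of each weight `α` as the scalar `φ α`. -/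
def diagOp (φ : LieModule.Weight ℂ h g → ℂ) : Module.End ℂ g :=
  (weightBasis h).constr ℂ fun i => φ i.1 • weightBasis h i

variable {h} {φ ψ : LieModule.Weight ℂ h g → ℂ}

@[simp]
theorem diagOp_weightBasis (i : WeightIndex h) :
    diagOp h φ (weightBasis h i) = φ i.1 • weightBasis h i :=
  (weightBasis h).constr_basis ℂ _ i

theorem diagOp_mul : diagOp h φ * diagOp h ψ = diagOp h fun α => φ α * ψ α := by
  refine (weightBasis h).ext fun i => ?_
  simp [smul_smul, mul_comm]

theorem diagOp_diagOp (x : g) : diagOp h φ (diagOp h ψ x) = diagOp h (fun α => φ α * ψ α) x := by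
  rw [← diagOp_mul]; rfl

theorem diagOp_add : diagOp h φ + diagOp h ψ = diagOp h fun α => φ α + ψ α := by
  refine (weightBasis h).ext fun i => ?_
  simp [add_smul]

theorem diagOp_sub : diagOp h φ - diagOp h ψ = diagOp h fun α => φ α - ψ α := by
  refine (weightBasis h).ext fun i => ?_
  simp [sub_smul]

theorem diagOp_one : diagOp h (fun _ => 1) = 1 := by
  refine (weightBasis h).ext fun i => ?_
  simp

theorem diagOp_zero : diagOp h (fun _ => 0) = 0 := by
  refine (weightBasis h).ext fun i => ?_
  simp

theorem aeval_diagOp (p : Polynomial ℂ) :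
    Polynomial.aeval (diagOp h φ) p = diagOp h fun α => p.eval (φ α) := by
  induction p using Polynomial.induction_on' with
  | add p q hp hq => simp only [map_add, hp, hq, diagOp_add, Polynomial.eval_add]
  | monomial n a =>
    rw [Polynomial.aeval_monomial]
    simp only [Polynomial.eval_monomial]
    induction n with
    | zero =>
      refine (weightBasis h).ext fun i => ?_
      simp [Algebra.algebraMap_eq_smul_one]
    | succ n ih => rw [pow_succ, ← mul_assoc, ih, diagOp_mul]; simp only [pow_succ, mul_assoc]

theorem trace_diagOp : LinearMap.trace ℂ g (diagOp h φ) =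
    ∑ α : LieModule.Weight ℂ h g,
      Module.finrank ℂ (LieAlgebra.rootSpace h α).toSubmodule * φ α := by
  classical
  rw [LinearMap.trace_eq_matrix_trace ℂ (weightBasis h), Matrix.trace, Fintype.sum_sigma]
  refine Finset.sum_congr rfl fun α _ => ?_
  simp [LinearMap.toMatrix_apply]

variable [LieAlgebra.IsSemisimple ℂ g]

variable (h) in
theorem lie_weightBasis (x : h) (i : WeightIndex h) :
    ⁅(x : g), weightBasis h i⁆ = i.1 x • weightBasis h i :=
  LieAlgebra.IsKilling.lie_eq_smul_of_mem_rootSpace (weightBasis_mem h i) x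

theorem ad_eq_diagOp (x : h) : LieAlgebra.ad ℂ g (x : g) = diagOp h fun α => α x := by
  refine (weightBasis h).ext fun i => ?_
  rw [diagOp_weightBasis, LieAlgebra.ad_apply, lie_weightBasis]

theorem lie_eq_diagOp (x : h) (y : g) : ⁅(x : g), y⁆ = diagOp h (fun α => α x) y := by
  rw [← ad_eq_diagOp]; rfl

/-- An operator of the form `diagOp h φ`, where `φ α` depends only on the number `α x`, is a
polynomial in `ad x`, so it preserves each subspace which `ad x` preserves. -/
theorem diagOp_mem_of_lie_mem {W : Submodule ℂ g} {x : h} (hW : ∀ y ∈ W, ⁅(x : g), y⁆ ∈ W)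
    (χ : ℂ → ℂ) {y : g} (hy : y ∈ W) : diagOp h (fun α => χ (α x)) y ∈ W := by
  classical
  let s : Finset ℂ := Finset.univ.image fun α : LieModule.Weight ℂ h g => α x
  let p := Lagrange.interpolate s id χ
  have hp : (fun α : LieModule.Weight ℂ h g => χ (α x)) = fun α => p.eval (α x) := by
    funext α
    have hα : α x ∈ s := Finset.mem_image_of_mem (fun α : LieModule.Weight ℂ h g => α x)
      (Finset.mem_univ α)
    exact (Lagrange.eval_interpolate_at_node (v := id) χ (Set.injOn_id _) hα).symm
  rw [hp, ← aeval_diagOp, ← ad_eq_diagOp]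
  induction p using Polynomial.induction_on' with
  | add p q hp hq => rw [map_add]; exact W.add_mem hp hq
  | monomial n a =>
    rw [Polynomial.aeval_monomial, Module.End.mul_apply, Module.algebraMap_end_apply]
    refine W.smul_mem _ ?_
    induction n with
    | zero => simpa using hy
    | succ n ih => rw [pow_succ', Module.End.mul_apply]; exact hW _ ih

theorem diagOp_of_mem_rootSpace {α : LieModule.Weight ℂ h g} {y : g}
    (hy : y ∈ LieAlgebra.rootSpace h α) : diagOp h φ y = φ α • y := by
  have key : ∀ i, (weightBasis h).repr y i ≠ 0 → i.1 = α := by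
    intro i hi
    refine LieModule.Weight.ext fun x => ?_
    have h₁ : ⁅(x : g), y⁆ = α x • y := LieAlgebra.IsKilling.lie_eq_smul_of_mem_rootSpace hy x
    have h₂ : ⁅(x : g), y⁆ =
        ∑ j, (weightBasis h).repr y j • j.1 x • weightBasis h j := by
      conv_lhs => rw [← (weightBasis h).sum_repr y]
      simp only [lie_sum, lie_smul, lie_weightBasis]
    have h₃ := congrArg (fun v => (weightBasis h).repr v i) (h₁.symm.trans h₂)
    simp only [map_smul, map_sum, Finsupp.smul_apply, Finsupp.finsetSum_apply, smul_eq_mul,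
      Module.Basis.repr_self] at h₃
    rw [Finset.sum_eq_single i (fun j _ hj => by simp [Finsupp.single_eq_of_ne' hj])
      (by simp)] at h₃
    simp only [Finsupp.single_eq_same, mul_one] at h₃
    exact (mul_right_cancel₀ hi (h₃.trans (mul_comm _ _))).symm
  conv_lhs => rw [← (weightBasis h).sum_repr y]
  conv_rhs => rw [← (weightBasis h).sum_repr y]
  rw [map_sum, Finset.smul_sum]
  refine Finset.sum_congr rfl fun i _ => ?_
  rw [map_smul, diagOp_weightBasis, smul_comm]
  by_cases hi : (weightBasis h).repr y i = 0
  · simp [hi]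
  · rw [key i hi]

theorem apply_weightBasis_eq_zero {B : LinearMap.BilinForm ℂ g} (hB : B.lieInvariant g)
    {i j : WeightIndex h} (hij : i.1 ≠ -j.1) : B (weightBasis h i) (weightBasis h j) = 0 := by
  by_contra hne
  refine hij (LieModule.Weight.ext fun x => ?_)
  have := hB (x : g) (weightBasis h i) (weightBasis h j)
  rw [lie_weightBasis, lie_weightBasis] at this
  simp only [map_smul, LinearMap.smul_apply, smul_eq_mul, ← neg_mul] at this
  simpa using mul_right_cancel₀ hne this

theorem apply_diagOp_left {B : LinearMap.BilinForm ℂ g} (hB : B.lieInvariant g) (x y : g) :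
    B (diagOp h φ x) y = B x (diagOp h (fun α => φ (-α)) y) := by
  suffices hs : B ∘ₗ diagOp h φ = B.compl₂ (diagOp h fun α => φ (-α)) from
    LinearMap.congr_fun (LinearMap.congr_fun hs x) y
  refine (weightBasis h).ext fun i => (weightBasis h).ext fun j => ?_
  simp only [LinearMap.comp_apply, LinearMap.compl₂_apply, diagOp_weightBasis, map_smul,
    LinearMap.smul_apply]
  by_cases hij : i.1 = -j.1
  · rw [hij]
  · rw [apply_weightBasis_eq_zero hB hij, smul_zero, smul_zero]

end DiagonalOperators

/-! ### The projection onto the positive root spaces -/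

section PositiveProjection

variable {g : Type*} [LieRing g] [LieAlgebra ℂ g] [FiniteDimensional ℂ g]
  {h : LieSubalgebra ℂ g} [h.IsCartanSubalgebra]

theorem mem_root {α : LieModule.Weight ℂ h g} : α ∈ h.root ↔ α.IsNonZero := by
  simp

theorem mem_posRoots {f : h} {α : LieModule.Weight ℂ h g} :
    α ∈ posRoots h f ↔ α ∈ h.root ∧ 0 < (α f).re := by
  simp [posRoots]

theorem weight_neg (α : LieModule.Weight ℂ h g) (x : h) : α (-x) = -α x := by
  exact map_neg α.toLinear x

open scoped Classical in
/-- The projection of `g` onto `𝔫` along the sum of the Cartan subalgebra and the root spaces of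
the negative roots. -/
def posProj (f : h) : Module.End ℂ g :=
  diagOp h fun α => if α ∈ posRoots h f then 1 else 0

theorem posProj_mem (f : h) (y : g) : posProj f y ∈ nPart h f := by
  rw [← (weightBasis h).sum_repr y, map_sum]
  refine Submodule.sum_mem _ fun i _ => ?_
  rw [map_smul, posProj, diagOp_weightBasis]
  refine Submodule.smul_mem _ _ ?_
  split_ifs with hi
  · rw [one_smul]
    exact Submodule.mem_iSup_of_mem i.1 (Submodule.mem_iSup_of_mem hi (weightBasis_mem h i))
  · rw [zero_smul]; exact Submodule.zero_mem _

open scoped Classical in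
theorem posProj_neg_posProj (f : h) (y : g) : posProj (-f) (posProj f y) = 0 := by
  rw [posProj, posProj, diagOp_diagOp]
  have : (fun α : LieModule.Weight ℂ h g => (if α ∈ posRoots h (-f) then (1 : ℂ) else 0) *
      if α ∈ posRoots h f then 1 else 0) = fun _ => 0 := by
    funext α
    by_cases h₁ : α ∈ posRoots h f <;> by_cases h₂ : α ∈ posRoots h (-f) <;>
      simp only [h₁, h₂, if_true, if_false, mul_zero, zero_mul]
    rw [mem_posRoots] at h₁ h₂
    have := h₂.2
    rw [weight_neg, Complex.neg_re] at this
    linarith [h₁.2]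
  rw [this, diagOp_zero, LinearMap.zero_apply]

/-- The remaining component of the triangular decomposition lies in the Cartan subalgebra. -/
theorem sub_posProj_mem_cartan {r : LieSubalgebra ℂ g} {fr f : h} (hf : IsAdapted h r fr f)
    (y : g) : y - posProj f y - posProj (-f) y ∈ h := by
  have : y - posProj f y - posProj (-f) y =
      (1 - posProj f - posProj (-f) : Module.End ℂ g) y := rfl
  rw [this, ← (weightBasis h).sum_repr y, map_sum]
  refine sum_mem fun i _ => ?_
  rw [map_smul]
  refine h.smul_mem _ ?_
  simp only [LinearMap.sub_apply, posProj, diagOp_weightBasis, Module.End.one_apply]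
  by_cases hi : i.1 ∈ h.root
  · have him := hf.hyperbolic _ hi
    have hne := hf.regular _ hi
    have hre : (i.1 f).re ≠ 0 := fun h0 => hne (Complex.ext h0 him)
    rcases lt_or_gt_of_ne hre with hlt | hgt
    · rw [if_neg (by rw [mem_posRoots]; rintro ⟨-, h2⟩; linarith), if_pos]
      · simp
      · rw [mem_posRoots, weight_neg]; exact ⟨hi, by simpa using hlt⟩
    · rw [if_pos (mem_posRoots.2 ⟨hi, hgt⟩), if_neg]
      · simp
      · rw [mem_posRoots, weight_neg, Complex.neg_re]
        rintro ⟨-, h2⟩; linarith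
  · rw [if_neg (fun hc => hi (mem_posRoots.1 hc).1), if_neg (fun hc => hi (mem_posRoots.1 hc).1)]
    have h0 : (i.1 : h → ℂ) = 0 := by
      rw [mem_root] at hi
      exact not_not.1 hi
    have hm := weightBasis_mem h i
    rw [h0] at hm
    have : weightBasis h i ∈ LieAlgebra.zeroRootSubalgebra ℂ g h := hm
    rw [LieAlgebra.zeroRootSubalgebra_eq_of_is_cartan] at this
    simpa using this

variable [LieAlgebra.IsSemisimple ℂ g]

theorem neg_mem_root {α : LieModule.Weight ℂ h g} : -α ∈ h.root ↔ α ∈ h.root := by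
  simp

theorem neg_mem_posRoots {f : h} {α : LieModule.Weight ℂ h g} :
    -α ∈ posRoots h f ↔ α ∈ posRoots h (-f) := by
  rw [mem_posRoots, mem_posRoots, neg_mem_root, weight_neg]
  rfl

/-- The conditions are symmetric under the exchange of positive and negative roots. -/
theorem IsAdapted.neg {r : LieSubalgebra ℂ g} {fr f : h} (hf : IsAdapted h r fr f) :
    IsAdapted h r (-fr) (-f) where
  exists_part := by
    obtain ⟨x, hx, h₁, h₂⟩ := hf.exists_part
    refine ⟨-x, by simpa using hx, fun α hα => ?_, fun α hα => ?_⟩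
    · rw [weight_neg, Complex.neg_im, h₁ α hα, neg_zero]
    · have := h₂ α hα
      rw [show Complex.I • (-x - -fr) = -(Complex.I • (x - fr)) by rw [← smul_neg]; congr 1; abel,
        weight_neg, Complex.neg_im, this, neg_zero]
  centralizer y := by
    rw [← hf.centralizer y, NegMemClass.coe_neg, neg_lie, neg_eq_zero]
  hyperbolic α hα := by rw [weight_neg, Complex.neg_im, hf.hyperbolic α hα, neg_zero]
  regular α hα := by rw [weight_neg]; exact neg_ne_zero.2 (hf.regular α hα)
  chamber α hα hpos := by
    have := hf.chamber (-α) (neg_mem_root.2 hα) (by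
      rw [weight_neg] at hpos
      exact hpos)
    rw [weight_neg]
    exact this

theorem posProj_of_mem {f : h} {y : g} (hy : y ∈ nPart h f) : posProj f y = y := by
  suffices hs : nPart h f ≤ LinearMap.ker (posProj f - 1) by
    simpa [sub_eq_zero] using hs hy
  refine iSup₂_le fun α hα x hx => ?_
  rw [LinearMap.mem_ker, LinearMap.sub_apply, posProj, diagOp_of_mem_rootSpace hx, if_pos hα]
  simp

/-- The projections onto `𝔫` and onto the sum of the negative root spaces are adjoint. -/
theorem apply_posProj_left {B : LinearMap.BilinForm ℂ g} (hB : B.lieInvariant g) (f : h) (x y : g) :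
    B (posProj f x) y = B x (posProj (-f) y) := by
  classical
  have : (fun α : LieModule.Weight ℂ h g => if -α ∈ posRoots h f then (1 : ℂ) else 0) =
      fun α => if α ∈ posRoots h (-f) then 1 else 0 :=
    funext fun α => if_congr neg_mem_posRoots rfl rfl
  rw [posProj, apply_diagOp_left hB, posProj, this]

theorem posProj_of_mem_cartan {f : h} {y : g} (hy : y ∈ h) : posProj f y = 0 := by
  by_cases hg : Subsingleton g
  · exact Subsingleton.elim _ _
  rw [not_subsingleton_iff_nontrivial] at hg
  have hy' : y ∈ LieAlgebra.rootSpace h (0 : LieModule.Weight ℂ h g) := by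
    have : y ∈ LieAlgebra.zeroRootSubalgebra ℂ g h := by
      rwa [LieAlgebra.zeroRootSubalgebra_eq_of_is_cartan]
    exact this
  rw [posProj, diagOp_of_mem_rootSpace hy', if_neg, zero_smul]
  rw [mem_posRoots, mem_root]
  rintro ⟨h₁, -⟩
  exact h₁ LieModule.Weight.isZero_zero

/-- The projection onto `𝔫` preserves `𝔯`. -/
theorem posProj_mem_subalgebra {r : LieSubalgebra ℂ g} (hr_cartan : (hr h r).IsCartanSubalgebra)
    {fr f : h} (hf : IsAdapted h r fr f) {y : g} (hy : y ∈ r) : posProj f y ∈ r := by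
  classical
  obtain ⟨x, hxr, hfr, hx⟩ := hf.exists_part
  have hre : ∀ α ∈ h.root, (α x).re = (α fr).re := by
    intro α hα
    have h₁ := hx α hα
    have : α (Complex.I • (x - fr)) = Complex.I * (α x - α fr) := by
      have h₁ := map_smul α.toLinear Complex.I (x - fr)
      have h₂ := map_sub α.toLinear x fr
      simp only [LieModule.Weight.toLinear_apply, smul_eq_mul] at h₁ h₂
      rw [h₁, h₂]
    rw [this] at h₁
    simp at h₁
    linarith
  have hrx : ∀ y ∈ r.toSubmodule, ⁅(x : g), y⁆ ∈ r.toSubmodule := fun y hy => r.lie_mem hxr hy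
  have hp : diagOp h (fun α => if 0 < (α x).re then (1 : ℂ) else 0) y ∈ r :=
    diagOp_mem_of_lie_mem hrx (fun c => if 0 < c.re then 1 else 0) hy
  have h0 : diagOp h (fun α => if (α x).re = 0 then (1 : ℂ) else 0) y ∈ r :=
    diagOp_mem_of_lie_mem hrx (fun c => if c.re = 0 then 1 else 0) hy
  set y₀ := diagOp h (fun α => if (α x).re = 0 then (1 : ℂ) else 0) y with hy₀
  have hroot : ∀ α : LieModule.Weight ℂ h g, α ∉ h.root → ∀ t : h, α t = 0 := by
    intro α hα t
    rw [mem_root] at hα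
    exact congrFun (not_not.1 hα) t
  -- the zero component of `y` centralizes `f_𝔯`, so it centralizes `𝔥 ∩ 𝔯` and lies in it
  have hcent : ⁅(fr : g), y₀⁆ = 0 := by
    rw [lie_eq_diagOp, hy₀, diagOp_diagOp]
    have : (fun α : LieModule.Weight ℂ h g =>
        α fr * if (α x).re = 0 then (1 : ℂ) else 0) = fun _ => 0 := by
      funext α
      split_ifs with hα
      · rw [mul_one]
        by_cases hαr : α ∈ h.root
        · exact Complex.ext ((hre α hαr).symm.trans hα) (hfr α hαr)
        · exact hroot α hαr fr
      · rw [mul_zero]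
    rw [this, diagOp_zero, LinearMap.zero_apply]
  have hy₀h : y₀ ∈ h := by
    have hmem : (⟨y₀, h0⟩ : r) ∈ (hr h r).normalizer := by
      rw [LieSubalgebra.mem_normalizer_iff]
      intro t ht
      have hz : ⁅(⟨y₀, h0⟩ : r), t⁆ = 0 := by
        rw [← lie_skew, neg_eq_zero]
        exact Subtype.ext ((hf.centralizer y₀).1 hcent (t : g) ht t.2)
      rw [hz]
      exact zero_mem _
    rw [hr_cartan.self_normalizing] at hmem
    exact hmem
  have hsplit : posProj f y =
      diagOp h (fun α => if 0 < (α x).re then (1 : ℂ) else 0) y + posProj f y₀ := by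
    rw [posProj, hy₀, diagOp_diagOp, ← LinearMap.add_apply, diagOp_add]
    congr 2
    funext α
    by_cases hαr : α ∈ h.root
    · rcases lt_trichotomy (α x).re 0 with hlt | heq | hgt
      · rw [if_neg (not_lt.2 hlt.le), if_neg hlt.ne, mul_zero, add_zero, if_neg]
        intro hα
        have := hf.chamber α hαr (mem_posRoots.1 hα).2
        rw [← hre α hαr] at this
        linarith
      · simp [heq]
      · rw [if_pos hgt, if_neg hgt.ne', mul_zero, add_zero, if_pos]
        rw [mem_posRoots]
        refine ⟨hαr, lt_of_not_ge fun hle => ?_⟩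
        have hne : (α f).re ≠ 0 := fun h0 =>
          hf.regular α hαr (Complex.ext h0 (hf.hyperbolic α hαr))
        have := hf.chamber (-α) (neg_mem_root.2 hαr)
          (by simpa using lt_of_le_of_ne hle hne)
        rw [hre α hαr] at hgt
        simp at this
        linarith
    · simp [hroot α hαr, mem_posRoots]
  rw [hsplit, posProj_of_mem_cartan hy₀h, add_zero]
  exact hp

theorem posProj_mem_pPart {B : LinearMap.BilinForm ℂ g} (hB : B.lieInvariant g)
    (hBsymm : B.IsSymm) {r : LieSubalgebra ℂ g} (hr_cartan : (hr h r).IsCartanSubalgebra)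
    {fr f : h} (hf : IsAdapted h r fr f) {y : g} (hy : y ∈ pPart B r) :
    posProj f y ∈ pPart B r := by
  intro x hx
  have h₁ := hy _ (posProj_mem_subalgebra hr_cartan hf.neg hx)
  change B x (posProj f y) = 0
  rw [hBsymm.eq, apply_posProj_left hB, hBsymm.eq]
  exact h₁

/-- The form `([x, y], w)` vanishes on the Borel subalgebra `𝔥 + 𝔫⁻`. -/
theorem apply_lie_sub_posProj {B : LinearMap.BilinForm ℂ g} (hB : B.lieInvariant g)
    {r : LieSubalgebra ℂ g} {fr f : h} (hf : IsAdapted h r fr f) (x y w : g) :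
    B ⁅x - posProj f x, y - posProj f y⁆ (w - posProj f w) = 0 := by
  classical
  have hsub : ∀ x, x - posProj f x =
      diagOp h (fun α => 1 - if α ∈ posRoots h f then 1 else 0) x := by
    intro x
    rw [← diagOp_sub, diagOp_one]; rfl
  have hvan : ∀ i j k : WeightIndex h, i.1 ∉ posRoots h f → j.1 ∉ posRoots h f →
      k.1 ∉ posRoots h f → B ⁅weightBasis h i, weightBasis h j⁆ (weightBasis h k) = 0 := by
    intro i j k hi hj hk
    have hle : ∀ α : LieModule.Weight ℂ h g, α ∉ posRoots h f → (α f).re ≤ 0 := by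
      intro α hα
      by_cases hαr : α ∈ h.root
      · rw [mem_posRoots] at hα
        exact not_lt.1 fun hlt => hα ⟨hαr, hlt⟩
      · rw [mem_root] at hαr
        rw [congrFun (not_not.1 hαr : (α : h → ℂ) = 0) f]; simp
    have hz : ∀ i : WeightIndex h, (i.1 f).re = 0 → weightBasis h i ∈ h := by
      intro i hi
      have h0 : (i.1 : h → ℂ) = 0 := by
        by_contra hne
        have hαr : i.1 ∈ h.root := mem_root.2 hne
        exact hf.regular _ hαr (Complex.ext hi (hf.hyperbolic _ hαr))
      have hm := weightBasis_mem h i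
      rw [h0] at hm
      have : weightBasis h i ∈ LieAlgebra.zeroRootSubalgebra ℂ g h := hm
      rwa [LieAlgebra.zeroRootSubalgebra_eq_of_is_cartan] at this
    -- `ad f`-invariance makes the three eigenvalues, all with real part `≤ 0`, sum to zero
    by_contra hne
    have hinv := hB (f : g) ⁅weightBasis h i, weightBasis h j⁆ (weightBasis h k)
    rw [leibniz_lie, lie_weightBasis, lie_weightBasis, lie_weightBasis, smul_lie, lie_smul,
      ← add_smul, map_smul, map_smul, LinearMap.smul_apply, smul_eq_mul, smul_eq_mul,
      ← neg_mul] at hinv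
    have hsum := congrArg Complex.re (mul_right_cancel₀ hne hinv)
    simp only [Complex.add_re, Complex.neg_re] at hsum
    have h₁ := hle _ hi
    have h₂ := hle _ hj
    have h₃ := hle _ hk
    have hih := hz i (by linarith)
    have hjh := hz j (by linarith)
    have hab : ⁅(⟨_, hih⟩ : h), (⟨_, hjh⟩ : h)⁆ = 0 := LieModule.IsTrivial.trivial _ _
    have hab' : ⁅weightBasis h i, weightBasis h j⁆ = 0 := congrArg Subtype.val hab
    rw [hab'] at hne
    simp at hne
  simp only [hsub]
  conv_lhs => rw [← (weightBasis h).sum_repr x, ← (weightBasis h).sum_repr y,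
    ← (weightBasis h).sum_repr w]
  simp only [map_sum, map_smul, diagOp_weightBasis, sum_lie, lie_sum, smul_lie, lie_smul,
    LinearMap.sum_apply, LinearMap.smul_apply]
  refine Finset.sum_eq_zero fun k _ => ?_
  by_cases hk : k.1 ∈ posRoots h f
  · simp [hk]
  rw [Finset.sum_eq_zero, smul_zero, smul_zero]
  intro j _
  by_cases hj : j.1 ∈ posRoots h f
  · simp [hj]
  rw [Finset.sum_eq_zero, smul_zero, smul_zero]
  intro i _
  by_cases hi : i.1 ∈ posRoots h f
  · simp [hi]
  rw [hvan _ _ _ hi hj hk, smul_zero, smul_zero]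

theorem trace_ad_mul_posProj_of_mem_cartan (f x : h) :
    LinearMap.trace ℂ g (LieAlgebra.ad ℂ g (x : g) * posProj f) = 2 * rho h f x := by
  classical
  rw [ad_eq_diagOp, posProj, diagOp_mul, trace_diagOp]
  have : 2 * rho h f x = ∑ α ∈ posRoots h f, α x := by
    simp [rho]
  rw [this, ← Finset.sum_filter_add_sum_filter_not Finset.univ (fun α => α ∈ posRoots h f)]
  rw [Finset.sum_eq_zero (s := Finset.univ.filter fun α => α ∉ posRoots h f), add_zero]
  · refine Finset.sum_congr (by ext; simp) fun α hα => ?_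
    have hα' := hα
    have h1 : Module.finrank ℂ (LieAlgebra.rootSpace h α).toSubmodule = 1 :=
      LieAlgebra.IsKilling.finrank_rootSpace_eq_one α (mem_root.1 (mem_posRoots.1 hα).1)
    rw [h1, if_pos hα]
    simp
  · intro α hα
    rw [if_neg (Finset.mem_filter.1 hα).2]
    simp

/-- This is the trace of a commutator, as `ad f` commutes with the projection. -/
theorem trace_ad_lie_mul_posProj (f : h) (y : g) :
    LinearMap.trace ℂ g (LieAlgebra.ad ℂ g ⁅(f : g), y⁆ * posProj f) = 0 := by
  have hcomm : LieAlgebra.ad ℂ g (f : g) * posProj f = posProj f * LieAlgebra.ad ℂ g (f : g) := by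
    rw [ad_eq_diagOp, posProj, diagOp_mul, diagOp_mul]
    simp only [mul_comm]
  have hlie : LieAlgebra.ad ℂ g ⁅(f : g), y⁆ =
      LieAlgebra.ad ℂ g (f : g) * LieAlgebra.ad ℂ g y -
        LieAlgebra.ad ℂ g y * LieAlgebra.ad ℂ g (f : g) :=
    LinearMap.ext fun x => lie_lie (f : g) y x
  rw [hlie, sub_mul, map_sub, mul_assoc, LinearMap.trace_mul_comm, mul_assoc, mul_assoc, hcomm,
    sub_self]

/-- `ad f` is invertible on the sum of the root spaces, because `f` is regular. -/
theorem exists_lie_eq_posProj {r : LieSubalgebra ℂ g} {fr f : h} (hf : IsAdapted h r fr f)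
    (s : h) (y : g) : ∃ x, ⁅(f : g), x⁆ = posProj s y := by
  classical
  refine ⟨diagOp h (fun α => (α f)⁻¹) (posProj s y), ?_⟩
  rw [lie_eq_diagOp, posProj, diagOp_diagOp, diagOp_diagOp]
  congr 2
  funext α
  split_ifs with hα
  · have := hf.regular α (mem_posRoots.1 hα).1
    field_simp
  · simp

/-- The trace of `ad y` on `𝔫`, compressed, is `2ρ` on the Cartan component of `y`. -/
theorem trace_ad_mul_posProj {r : LieSubalgebra ℂ g} {fr f : h} (hf : IsAdapted h r fr f) (y : g) :
    LinearMap.trace ℂ g (LieAlgebra.ad ℂ g y * posProj f) =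
      2 * rho h f ⟨_, sub_posProj_mem_cartan hf y⟩ := by
  obtain ⟨a, ha⟩ := exists_lie_eq_posProj hf f y
  obtain ⟨c, hc⟩ := exists_lie_eq_posProj hf (-f) y
  have hy : y = (y - posProj f y - posProj (-f) y) + ⁅(f : g), a⁆ + ⁅(f : g), c⁆ := by
    rw [ha, hc]; abel
  conv_lhs => rw [hy]
  rw [map_add, map_add, add_mul, add_mul, map_add, map_add, trace_ad_lie_mul_posProj,
    trace_ad_lie_mul_posProj, add_zero, add_zero]
  exact trace_ad_mul_posProj_of_mem_cartan f ⟨_, sub_posProj_mem_cartan hf y⟩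

end PositiveProjection

/-! ### Irreducible highest weight modules -/

section HighestWeight

variable {g : Type*} [LieRing g] [LieAlgebra ℂ g] [FiniteDimensional ℂ g]
  {h : LieSubalgebra ℂ g} [h.IsCartanSubalgebra] {r : LieSubalgebra ℂ g} {fr f : h}

/-- The component of `y` in the Cartan subalgebra, for the triangular decomposition of `g`. -/
def cartanPart (hf : IsAdapted h r fr f) (y : g) : h :=
  ⟨_, sub_posProj_mem_cartan hf y⟩

theorem eq_cartanPart_add (hf : IsAdapted h r fr f) (y : g) :
    y = (cartanPart hf y : g) + posProj f y + posProj (-f) y := by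
  simp only [cartanPart]
  abel

variable {lam : Module.Dual ℂ h} {V : Type*} [AddCommGroup V] [Module ℂ V] [LieRingModule g V]
  [LieModule ℂ g V] {v : V}

/-- An irreducible highest weight module is generated by its highest weight vector under the
action of `𝔫⁻` alone. -/
theorem eq_top_of_lie_mem (hf : IsAdapted h r fr f)
    (hV : IsIrreducibleHighestWeight h f lam V v) {W : Submodule ℂ V} (hv : v ∈ W)
    (hW : ∀ x ∈ nPart h (-f), ∀ y ∈ W, ⁅x, y⁆ ∈ W) : W = ⊤ := by
  -- the smallest subspace which contains `v` and is stable under `𝔫⁻`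
  let W₀ : Submodule ℂ V :=
    sInf {W | v ∈ W ∧ ∀ x ∈ nPart h (-f), ∀ y ∈ W, ⁅x, y⁆ ∈ W}
  have hv₀ : v ∈ W₀ := Submodule.mem_sInf.2 fun W hW => hW.1
  have hW₀ : ∀ x ∈ nPart h (-f), ∀ y ∈ W₀, ⁅x, y⁆ ∈ W₀ := fun x hx y hy =>
    Submodule.mem_sInf.2 fun W hW => hW.2 x hx y (Submodule.mem_sInf.1 hy W hW)
  let W₁ : Submodule ℂ V :=
    { carrier := {y | y ∈ W₀ ∧ ∀ e : g, ⁅e, y⁆ ∈ W₀}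
      add_mem' := fun ha hb => ⟨add_mem ha.1 hb.1, fun e => by
        rw [lie_add]; exact add_mem (ha.2 e) (hb.2 e)⟩
      zero_mem' := ⟨zero_mem _, fun e => by rw [lie_zero]; exact zero_mem _⟩
      smul_mem' := fun c _ ha => ⟨W₀.smul_mem c ha.1, fun e => by
        rw [lie_smul]; exact W₀.smul_mem c (ha.2 e)⟩ }
  have hle : W₀ ≤ W₁ := by
    refine sInf_le ⟨⟨hv₀, fun e => ?_⟩, fun x hx y hy => ⟨hW₀ x hx y hy.1, fun e => ?_⟩⟩
    · rw [eq_cartanPart_add hf e, add_lie, add_lie, hV.weight,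
        hV.annihilated _ (posProj_mem f e), add_zero]
      exact add_mem (W₀.smul_mem _ hv₀) (hW₀ _ (posProj_mem _ _) _ hv₀)
    · rw [leibniz_lie]
      exact add_mem (hy.2 _) (hW₀ x hx _ (hy.2 e))
  let K : LieSubmodule ℂ g V := { W₀ with lie_mem := fun {x y} hy => (hle hy).2 x }
  have : LieModule.IsIrreducible ℂ g V := hV.irreducible
  have hK : K = ⊤ := (eq_bot_or_eq_top K).resolve_left fun hbot => by
    have hvK : v ∈ K := hv₀
    rw [hbot, LieSubmodule.mem_bot] at hvK
    exact hV.ne_zero hvK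
  refine top_le_iff.1 fun y _ => ?_
  have hy : y ∈ K := hK ▸ LieSubmodule.mem_top y
  exact Submodule.mem_sInf.1 hy W ⟨hv, hW⟩

variable [LieAlgebra.IsSemisimple ℂ g]

theorem lie_mem_nPart (x : h) {y : g} (hy : y ∈ nPart h f) : ⁅(x : g), y⁆ ∈ nPart h f := by
  have : ⁅(x : g), y⁆ = posProj f ⁅(x : g), y⁆ := by
    conv_lhs => rw [← posProj_of_mem hy]
    rw [lie_eq_diagOp, lie_eq_diagOp, posProj, diagOp_diagOp, diagOp_diagOp]
    simp only [mul_comm]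
  rw [this]
  exact posProj_mem _ _

/-- The vector `v` is not in `𝔫⁻ V`: on the latter, the eigenvalues of `f` have real part smaller
than that of `λ(f)`. -/
theorem notMem_span_lie (hf : IsAdapted h r fr f) (hV : IsIrreducibleHighestWeight h f lam V v) :
    v ∉ Submodule.span ℂ {y : V | ∃ x ∈ nPart h (-f), ∃ w : V, ⁅x, w⁆ = y} := by
  -- `G` is the sum of the eigenspaces of `f` below the one of `v`
  let E := (LieModule.toEnd ℂ g V (f : g)).eigenspace
  let G : Submodule ℂ V := ⨆ μ ∈ {μ : ℂ | μ.re < (lam f).re}, E μ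
  have hvE : v ∈ E (lam f) := Module.End.mem_eigenspace_iff.2 (hV.weight f)
  have hEG : ∀ μ, μ.re ≤ (lam f).re → ∀ x ∈ nPart h (-f), ∀ y ∈ E μ, ⁅x, y⁆ ∈ G := by
    intro μ hμ x hx y hy
    induction hx using Submodule.iSup_induction' with
    | zero => rw [zero_lie]; exact zero_mem _
    | add a b _ _ ha hb => rw [add_lie]; exact add_mem ha hb
    | mem α x hx =>
      by_cases hα : α ∈ posRoots h (-f)
      · simp only [hα, iSup_pos] at hx
        have hlie : ⁅(f : g), x⁆ = α f • x :=
          LieAlgebra.IsKilling.lie_eq_smul_of_mem_rootSpace hx f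
        have hneg := (mem_posRoots.1 hα).2
        rw [weight_neg, Complex.neg_re] at hneg
        refine Submodule.mem_iSup_of_mem (α f + μ) (Submodule.mem_iSup_of_mem ?_ ?_)
        · change (α f + μ).re < _
          rw [Complex.add_re]
          linarith
        · have hy' : ⁅(f : g), y⁆ = μ • y := Module.End.mem_eigenspace_iff.1 hy
          refine Module.End.mem_eigenspace_iff.2 ?_
          change ⁅(f : g), ⁅x, y⁆⁆ = _
          rw [leibniz_lie, hlie, hy', smul_lie, lie_smul, ← add_smul]
      · simp only [hα, not_false_eq_true, iSup_neg, Submodule.mem_bot] at hx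
        rw [hx, zero_lie]; exact zero_mem _
  have hstep : ∀ x ∈ nPart h (-f), ∀ y ∈ Submodule.span ℂ {v} ⊔ G, ⁅x, y⁆ ∈ G := by
    intro x hx y hy
    obtain ⟨a, ha, b, hb, rfl⟩ := Submodule.mem_sup.1 hy
    obtain ⟨c, rfl⟩ := Submodule.mem_span_singleton.1 ha
    rw [lie_add, lie_smul]
    refine add_mem (G.smul_mem _ (hEG _ le_rfl x hx v hvE)) ?_
    suffices hs : G ≤ G.comap (LieModule.toEnd ℂ g V x) from hs hb
    exact iSup₂_le fun μ hμ y hy => hEG μ (le_of_lt hμ) x hx y hy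
  have htop := eq_top_of_lie_mem hf hV (W := Submodule.span ℂ {v} ⊔ G)
    (Submodule.mem_sup_left (Submodule.mem_span_singleton_self v))
    (fun x hx y hy => Submodule.mem_sup_right (hstep x hx y hy))
  intro hmem
  have hvG : v ∈ G := by
    refine (Submodule.span_le.2 ?_ : _ ≤ G) hmem
    rintro _ ⟨x, hx, w, rfl⟩
    exact hstep x hx w (htop ▸ Submodule.mem_top)
  have hdisj := (LieModule.toEnd ℂ g V (f : g)).eigenspaces_iSupIndep (lam f)
  refine hV.ne_zero (Submodule.disjoint_def.1 hdisj v hvE ?_)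
  refine (iSup₂_le fun μ hμ => ?_ : G ≤ _) hvG
  refine le_iSup₂_of_le μ ?_ le_rfl
  rintro rfl
  exact lt_irrefl (lam f).re hμ

/-- The coordinate of the highest weight vector is a lowest weight vector of the dual module. -/
theorem exists_highestWeight_coordinate (hf : IsAdapted h r fr f)
    (hV : IsIrreducibleHighestWeight h f lam V v) :
    ∃ φ : Module.Dual ℂ V, φ v = 1 ∧ (∀ x ∈ nPart h (-f), ∀ y, φ ⁅x, y⁆ = 0) ∧
      ∀ (x : h) (y : V), φ ⁅(x : g), y⁆ = lam x * φ y := by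
  set U := Submodule.span ℂ {y : V | ∃ x ∈ nPart h (-f), ∃ w : V, ⁅x, w⁆ = y} with hU
  obtain ⟨ψ, hψv, hψU⟩ := Submodule.exists_le_ker_of_notMem (notMem_span_lie hf hV)
  have hUmem : ∀ x ∈ nPart h (-f), ∀ y : V, ⁅x, y⁆ ∈ U := fun x hx y =>
    Submodule.subset_span ⟨x, hx, y, rfl⟩
  have htop : Submodule.span ℂ {v} ⊔ U = ⊤ := eq_top_of_lie_mem hf hV
    (Submodule.mem_sup_left (Submodule.mem_span_singleton_self v))
    (fun x hx y _ => Submodule.mem_sup_right (hUmem x hx y))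
  have hUlie : ∀ x : h, U ≤ U.comap (LieModule.toEnd ℂ g V (x : g)) := by
    intro x
    refine Submodule.span_le.2 ?_
    rintro _ ⟨n, hn, w, rfl⟩
    change ⁅(x : g), ⁅n, w⁆⁆ ∈ U
    rw [leibniz_lie]
    exact add_mem (hUmem _ (lie_mem_nPart x hn) _) (hUmem _ hn _)
  refine ⟨(ψ v)⁻¹ • ψ, by simp [hψv], fun x hx y => ?_, fun x y => ?_⟩
  · rw [LinearMap.smul_apply, LinearMap.mem_ker.1 (hψU (hUmem x hx y)), smul_zero]
  · have hy : y ∈ Submodule.span ℂ {v} ⊔ U := htop ▸ Submodule.mem_top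
    obtain ⟨a, ha, b, hb, rfl⟩ := Submodule.mem_sup.1 hy
    obtain ⟨c, rfl⟩ := Submodule.mem_span_singleton.1 ha
    have h₁ : ψ ⁅(x : g), b⁆ = 0 := LinearMap.mem_ker.1 (hψU (hUlie x hb))
    have h₂ : ψ b = 0 := LinearMap.mem_ker.1 (hψU hb)
    simp only [LinearMap.smul_apply, lie_add, lie_smul, map_add, map_smul, hV.weight, h₁, h₂,
      smul_eq_mul]
    ring

end HighestWeight

/-! ### Traces and the decomposition into `𝔯` and `𝔭` -/

section Trace

variable {g : Type*} [LieRing g] [LieAlgebra ℂ g]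
  {B : LinearMap.BilinForm ℂ g} {r : LieSubalgebra ℂ g} {κ : Type*} [Fintype κ]
  {z : Module.Basis κ ℂ (pPart B r)}

theorem pForm_isSymm (hB : B.IsSymm) : (pForm B r).IsSymm :=
  ⟨fun x y => hB.eq x y⟩

theorem sum_pForm_smul (hz : IsOrthonormalBasis B r z) (y : pPart B r) :
    ∑ i, pForm B r (z i) y • z i = y := by
  have key : ∀ i, pForm B r (z i) y = z.repr y i := by
    intro i
    conv_lhs => rw [← z.sum_repr y]
    simp only [map_sum, map_smul, smul_eq_mul]
    rw [Finset.sum_eq_single i (fun j _ hj => by rw [hz.2 i j hj.symm, mul_zero]) (by simp),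
      hz.1 i, mul_one]
  simp only [key]
  exact z.sum_repr y

/-- If `A` maps `𝔯` to `𝔭`, then the diagonal block of `A` on `𝔯` does not contribute to the
trace. -/
theorem trace_eq_sum_of_mapsTo [FiniteDimensional ℂ g] (hB : B.IsSymm)
    (hr : (B.restrict r.toSubmodule).Nondegenerate)
    (hz : IsOrthonormalBasis B r z) {A : Module.End ℂ g} (hA : ∀ x ∈ r, A x ∈ pPart B r) :
    LinearMap.trace ℂ g A = ∑ j, B (A (z j)) (z j) := by
  -- the orthogonal projection onto `𝔭`
  set S : Module.End ℂ g := ∑ j, (B (z j)).smulRight (z j : g) with hS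
  have hSapp : ∀ x, S x = ∑ j, B (z j) x • (z j : g) := by
    intro x
    simp [hS]
  have hSp : ∀ x ∈ pPart B r, S x = x := by
    intro x hx
    have := congrArg Subtype.val (sum_pForm_smul hz ⟨x, hx⟩)
    rw [hSapp]
    rw [Submodule.coe_sum] at this
    exact this
  have hSr : ∀ x ∈ r, S x = 0 := by
    intro x hx
    rw [hSapp]
    refine Finset.sum_eq_zero fun j _ => ?_
    have : B x (z j) = 0 := (z j).2 x hx
    rw [hB.eq, this, zero_smul]
  have hcompl := LinearMap.BilinForm.isCompl_orthogonal_of_restrict_nondegenerate hB.isRefl hr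
  have hmem : ∀ x, x - S x ∈ r := by
    intro x
    have hx : x ∈ r.toSubmodule ⊔ pPart B r := hcompl.sup_eq_top ▸ Submodule.mem_top
    obtain ⟨a, ha, c, hc, rfl⟩ := Submodule.mem_sup.1 hx
    rw [map_add, hSr a ha, hSp c hc, zero_add, add_sub_cancel_right]
    exact ha
  have hidem : (1 - S) * (1 - S) = 1 - S := by
    ext x
    simp only [Module.End.mul_apply, LinearMap.sub_apply, Module.End.one_apply]
    rw [hSr _ (hmem x), sub_zero]
  have hzero : (1 - S) * (A * (1 - S)) = 0 := by
    ext x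
    simp only [Module.End.mul_apply, LinearMap.sub_apply, Module.End.one_apply,
      LinearMap.zero_apply]
    rw [hSp _ (hA _ (hmem x)), sub_self]
  have hsplit : A = A * S + A * (1 - S) * (1 - S) := by
    rw [mul_assoc, hidem, ← mul_add, add_sub_cancel, mul_one]
  conv_lhs => rw [hsplit]
  rw [map_add, LinearMap.trace_mul_comm ℂ (A * (1 - S)), hzero, map_zero, add_zero, hS,
    Finset.mul_sum, map_sum]
  refine Finset.sum_congr rfl fun j _ => ?_
  have : A * (B (z j)).smulRight (z j : g) = (B (z j)).smulRight (A (z j)) := by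
    ext x; simp
  rw [this, LinearMap.trace_smulRight, hB.eq]

end Trace

section TraceOnP

variable {g : Type*} [LieRing g] [LieAlgebra ℂ g] [FiniteDimensional ℂ g]
  [LieAlgebra.IsSemisimple ℂ g] {h : LieSubalgebra ℂ g} [h.IsCartanSubalgebra]
  {B : LinearMap.BilinForm ℂ g} {r : LieSubalgebra ℂ g} {fr f : h} {κ : Type*} [Fintype κ]
  {z : Module.Basis κ ℂ (pPart B r)}

/-- The trace functional of the normal ordering formula, for `T(x, y, w) = ([x, y], w)` on `𝔭`, is
`2ρ` on the Cartan component. -/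
theorem sum_apply_lie_posProj (hB : B.IsSymm) (hBinv : B.lieInvariant g)
    (hr_nondeg : (B.restrict r.toSubmodule).Nondegenerate)
    (hr_cartan : (hr h r).IsCartanSubalgebra) (hf : IsAdapted h r fr f)
    (hz : IsOrthonormalBasis B r z) {y : g} (hy : y ∈ pPart B r) :
    ∑ j, B ⁅y, posProj f (z j : g)⁆ (z j) = 2 * rho h f (cartanPart hf y) := by
  rw [cartanPart, ← trace_ad_mul_posProj hf y, trace_eq_sum_of_mapsTo hB hr_nondeg hz]
  · rfl
  · intro x hx w hw
    change B w ⁅y, posProj f x⁆ = 0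
    have h₁ : B ⁅posProj f x, w⁆ y = 0 :=
      hy _ (r.lie_mem (posProj_mem_subalgebra hr_cartan hf hx) hw)
    rw [hBinv, ← lie_skew, map_neg, neg_neg] at h₁
    exact h₁

end TraceOnP

/-! ### The cubic element in the Clifford algebra -/

section Cubic

open CliffordAlgebra

variable {g : Type*} [LieRing g] [LieAlgebra ℂ g] {B : LinearMap.BilinForm ℂ g}
  {r : LieSubalgebra ℂ g} {κ : Type*} [Fintype κ] {z : Module.Basis κ ℂ (pPart B r)}

variable (B r) in
/-- The trilinear form `([x, y], w)` on `𝔭`. -/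
def bracketForm : pPart B r →ₗ[ℂ] pPart B r →ₗ[ℂ] pPart B r →ₗ[ℂ] ℂ :=
  LinearMap.mk₂ ℂ (fun x y => B ⁅(x : g), (y : g)⁆ ∘ₗ (pPart B r).subtype)
    (fun _ _ _ => by ext; simp) (fun _ _ _ => by ext; simp)
    (fun _ _ _ => by ext; simp) (fun _ _ _ => by ext; simp)

theorem bracketForm_apply (x y w : pPart B r) :
    bracketForm B r x y w = B ⁅(x : g), (y : g)⁆ w :=
  rfl

theorem bracketForm_swap₁ (x y w : pPart B r) :
    bracketForm B r y x w = -bracketForm B r x y w := by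
  rw [bracketForm_apply, bracketForm_apply, ← lie_skew, map_neg, LinearMap.neg_apply]

theorem bracketForm_swap₂ (hB : B.IsSymm) (hBinv : B.lieInvariant g) (x y w : pPart B r) :
    bracketForm B r x w y = -bracketForm B r x y w := by
  rw [bracketForm_apply, bracketForm_apply, hBinv, hB.eq]

theorem equivExterior_symm_cubicElement (hB : B.IsSymm) (hBinv : B.lieInvariant g)
    (hz : IsOrthonormalBasis B r z) :
    (equivExterior (pQuad B r)).symm (cubicElement B r z : ExteriorAlgebra ℂ (pPart B r)) =
      (-1 / 12 : ℂ) • ∑ i, ∑ j, ∑ k, bracketForm B r (z i) (z j) (z k) •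
        (ι (pQuad B r) (z i) * (ι (pQuad B r) (z j) * ι (pQuad B r) (z k))) := by
  simp only [cubicElement, Submodule.coe_smul, Submodule.coe_sum, map_smul, map_sum]
  congr 1
  refine Finset.sum_congr rfl fun i _ => Finset.sum_congr rfl fun j _ =>
    Finset.sum_congr rfl fun k _ => ?_
  rw [← bracketForm_apply]
  -- a coefficient with two equal indices vanishes
  have self_eq_zero : ∀ {a : ℂ}, a = -a → a = 0 := fun h => by
    linear_combination (1 / 2 : ℂ) * h
  by_cases hij : i = j
  · subst hij
    rw [self_eq_zero (bracketForm_swap₁ (z i) (z i) (z k)), zero_smul, zero_smul]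
  by_cases hjk : j = k
  · subst hjk
    rw [self_eq_zero (bracketForm_swap₂ hB hBinv (z i) (z j) (z j)), zero_smul, zero_smul]
  by_cases hik : i = k
  · subst hik
    have h : bracketForm B r (z i) (z j) (z i) = 0 := by
      rw [bracketForm_swap₂ hB hBinv, self_eq_zero (bracketForm_swap₁ (z i) (z i) (z j)), neg_zero]
    rw [h, zero_smul, zero_smul]
  congr 1
  exact equivExterior_symm_ιMulti (hz.2 i j hij) (hz.2 i k hik) (hz.2 j k hjk) (pForm_isSymm hB)

end Cubic

/-! ### The triangular decomposition of `𝔭` -/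

section Triangular

open CliffordAlgebra

variable {g : Type*} [LieRing g] [LieAlgebra ℂ g] [FiniteDimensional ℂ g]
  [LieAlgebra.IsSemisimple ℂ g] {h : LieSubalgebra ℂ g} [h.IsCartanSubalgebra]
  {B : LinearMap.BilinForm ℂ g} {r : LieSubalgebra ℂ g} {fr f : h} {κ : Type*} [Fintype κ]
  {z : Module.Basis κ ℂ (pPart B r)}
  (hB : B.IsSymm) (hBinv : B.lieInvariant g) (hr_cartan : (hr h r).IsCartanSubalgebra)
  (hf : IsAdapted h r fr f)

/-- The projection of `𝔭` onto `𝔫 ∩ 𝔭`, the restriction of `posProj`. -/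
def pProj : Module.End ℂ (pPart B r) :=
  (posProj f).restrict fun _ hy => posProj_mem_pPart hBinv hB hr_cartan hf hy

@[simp]
theorem coe_pProj (x : pPart B r) :
    (pProj hB hBinv hr_cartan hf x : g) = posProj f (x : g) :=
  rfl

theorem pForm_pProj_left (x y : pPart B r) :
    pForm B r (pProj hB hBinv hr_cartan hf x) y =
      pForm B r x (pProj hB hBinv hr_cartan hf.neg y) :=
  apply_posProj_left hBinv f (x : g) y

theorem pProj_neg_pProj (x : pPart B r) :
    pProj hB hBinv hr_cartan hf.neg (pProj hB hBinv hr_cartan hf x) = 0 :=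
  Subtype.ext (posProj_neg_posProj f (x : g))

theorem pProj_pProj_neg (x : pPart B r) :
    pProj hB hBinv hr_cartan hf (pProj hB hBinv hr_cartan hf.neg x) = 0 := by
  have := posProj_neg_posProj (-f) (x : g)
  rw [neg_neg] at this
  exact Subtype.ext this

theorem pProj_mem_np (x : pPart B r) : pProj hB hBinv hr_cartan hf x ∈ np h B r f :=
  posProj_mem f (x : g)

theorem pProj_of_mem_np {x : pPart B r} (hx : x ∈ np h B r f) :
    pProj hB hBinv hr_cartan hf x = x :=
  Subtype.ext (posProj_of_mem hx)

theorem pProj_of_mem_hp {x : pPart B r} (hx : x ∈ hp B h r) :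
    pProj hB hBinv hr_cartan hf x = 0 :=
  Subtype.ext (posProj_of_mem_cartan hx)

theorem cartanPart_mem_pPart (hB : B.IsSymm) (hBinv : B.lieInvariant g)
    (hr_cartan : (hr h r).IsCartanSubalgebra) (hf : IsAdapted h r fr f) {y : g}
    (hy : y ∈ pPart B r) : (cartanPart hf y : g) ∈ pPart B r :=
  sub_mem (sub_mem hy (posProj_mem_pPart hBinv hB hr_cartan hf hy))
    (posProj_mem_pPart hBinv hB hr_cartan hf.neg hy)

end Triangular

/-! ### The action on `V ⊗ L` -/

section Action

open CliffordAlgebra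

theorem span_range_coe_basis {M : Type*} [AddCommGroup M] [Module ℂ M] {A : Submodule ℂ M}
    {κ : Type*} (w : Module.Basis κ ℂ A) : Submodule.span ℂ (Set.range fun i => (w i : M)) = A := by
  have := congrArg (Submodule.map A.subtype) w.span_eq
  rwa [Submodule.map_span, ← Set.range_comp, Submodule.map_subtype_top] at this

variable {g : Type*} [LieRing g] [LieAlgebra ℂ g] {B : LinearMap.BilinForm ℂ g}
  {r : LieSubalgebra ℂ g} {V : Type*} [AddCommGroup V] [Module ℂ V] {u : Cl B r}

variable (B r u) in
/-- The linear map `y ⊗ l ↦ φ(y) s l` from `V ⊗ L` to the Clifford algebra. -/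
def pairing (φ : Module.Dual ℂ V) (s : Cl B r) : V ⊗[ℂ] leftIdeal B r u →ₗ[ℂ] Cl B r :=
  TensorProduct.lift (LinearMap.mk₂ ℂ (fun y l => φ y • (s * (l : Cl B r)))
    (fun _ _ _ => by simp [add_smul]) (fun _ _ _ => by simp [mul_smul])
    (fun _ _ _ => by simp [mul_add]) (fun c y l => by
      rw [Submodule.coe_smul_of_tower, mul_smul_comm, smul_comm]))

theorem pairing_tmul (φ : Module.Dual ℂ V) (s : Cl B r) (y : V) (l : leftIdeal B r u) :
    pairing B r u φ s (y ⊗ₜ[ℂ] l) = φ y • (s * (l : Cl B r)) :=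
  rfl

theorem xi_dirac_tmul [LieRingModule g V] [LieModule ℂ g V] {κ : Type*} [Fintype κ]
    {z : Module.Basis κ ℂ (pPart B r)} (y : V) (l : leftIdeal B r u) :
    xi B r V u (dirac B r z) (y ⊗ₜ[ℂ] l) =
      (∑ i, ⁅(z i : g), y⁆ ⊗ₜ[ℂ] (ι (pQuad B r) (z i) • l)) +
        y ⊗ₜ[ℂ] ((equivExterior (pQuad B r)).symm
          (cubicElement B r z : ExteriorAlgebra ℂ (pPart B r)) • l) := by
  rw [dirac, map_add, map_sum, LinearMap.add_apply, LinearMap.sum_apply]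
  congr 1
  · exact Finset.sum_congr rfl fun i _ => xi_tmul B r V u _ _ _ _
  · rw [xi, tensorAction_tmul, map_one]
    rfl

end Action

/-! ### The Dirac operator on vacuum vectors -/

section Dirac

open CliffordAlgebra

variable {g : Type*} [LieRing g] [LieAlgebra ℂ g] [FiniteDimensional ℂ g]
  [LieAlgebra.IsSemisimple ℂ g] {h : LieSubalgebra ℂ g} [h.IsCartanSubalgebra]
  {B : LinearMap.BilinForm ℂ g} {r : LieSubalgebra ℂ g} {fr f : h} {κ : Type*} [Fintype κ]
  {z : Module.Basis κ ℂ (pPart B r)}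

/-- The cubic term acts as `ρ` on the vectors which `𝔫 ∩ 𝔭` annihilates from the left. -/
theorem cubic_mul (hB : B.IsSymm) (hBinv : B.lieInvariant g)
    (hr_nondeg : (B.restrict r.toSubmodule).Nondegenerate)
    (hr_cartan : (hr h r).IsCartanSubalgebra) (hf : IsAdapted h r fr f)
    (hz : IsOrthonormalBasis B r z) {l : Cl B r}
    (hl : ∀ x, ι (pQuad B r) (pProj hB hBinv hr_cartan hf x) * l = 0) :
    (equivExterior (pQuad B r)).symm (cubicElement B r z : ExteriorAlgebra ℂ (pPart B r)) * l =
      ∑ i, rho h f (cartanPart hf (z i : g)) • (ι (pQuad B r) (z i) * l) := by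
  have key := cubicSum_mul (Q := pQuad B r) (T := bracketForm B r) rfl (pForm_isSymm hB)
    (sum_pForm_smul hz) bracketForm_swap₁ (bracketForm_swap₂ hB hBinv)
    (pForm_pProj_left hB hBinv hr_cartan hf)
    (pProj_neg_pProj hB hBinv hr_cartan hf)
    (fun x y w => apply_lie_sub_posProj hBinv hf.neg (x : g) y w) hl
  rw [equivExterior_symm_cubicElement hB hBinv hz, smul_mul_assoc]
  refine (congrArg _ key).trans ?_
  rw [smul_smul, Finset.smul_sum]
  refine Finset.sum_congr rfl fun i _ => ?_
  have hmem : (z i : g) - posProj (-f) (z i : g) ∈ pPart B r :=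
    sub_mem (z i).2 (posProj_mem_pPart hBinv hB hr_cartan hf.neg (z i).2)
  have htr := sum_apply_lie_posProj hB hBinv hr_nondeg hr_cartan hf hz hmem
  have hcp : cartanPart hf ((z i : g) - posProj (-f) (z i : g)) = cartanPart hf (z i : g) := by
    refine Subtype.ext ?_
    have h₁ := posProj_neg_posProj (-f) (z i : g)
    rw [neg_neg] at h₁
    have h₂ := posProj_of_mem (posProj_mem (-f) (z i : g))
    simp only [cartanPart, map_sub, h₁, h₂]
    abel
  rw [hcp] at htr
  have htr' : ∑ j, bracketForm B r (z i - pProj hB hBinv hr_cartan hf.neg (z i))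
      (pProj hB hBinv hr_cartan hf (z j)) (z j) = 2 * rho h f (cartanPart hf (z i : g)) := htr
  rw [htr', smul_smul]
  congr 1
  ring

/-- The cubic term acts as `ρ` on the vectors which `𝔫⁻ ∩ 𝔭` annihilates from the right. -/
theorem mul_cubic (hB : B.IsSymm) (hBinv : B.lieInvariant g)
    (hr_nondeg : (B.restrict r.toSubmodule).Nondegenerate)
    (hr_cartan : (hr h r).IsCartanSubalgebra) (hf : IsAdapted h r fr f)
    (hz : IsOrthonormalBasis B r z) {l : Cl B r}
    (hl : ∀ x, l * ι (pQuad B r) (pProj hB hBinv hr_cartan hf.neg x) = 0) :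
    l * (equivExterior (pQuad B r)).symm (cubicElement B r z : ExteriorAlgebra ℂ (pPart B r)) =
      ∑ i, rho h f (cartanPart hf (z i : g)) • (l * ι (pQuad B r) (z i)) := by
  have key := mul_cubicSum (Q := pQuad B r) (T := bracketForm B r) rfl (pForm_isSymm hB)
    (sum_pForm_smul hz) bracketForm_swap₁ (bracketForm_swap₂ hB hBinv)
    (pForm_pProj_left hB hBinv hr_cartan hf)
    (pProj_pProj_neg hB hBinv hr_cartan hf)
    (fun x y w => apply_lie_sub_posProj hBinv hf (x : g) y w) hl
  rw [equivExterior_symm_cubicElement hB hBinv hz, mul_smul_comm]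
  refine (congrArg _ key).trans ?_
  rw [smul_smul, Finset.smul_sum]
  refine Finset.sum_congr rfl fun i _ => ?_
  have hmem : (z i : g) - posProj f (z i : g) ∈ pPart B r :=
    sub_mem (z i).2 (posProj_mem_pPart hBinv hB hr_cartan hf (z i).2)
  have htr := sum_apply_lie_posProj hB hBinv hr_nondeg hr_cartan hf hz hmem
  have hcp : cartanPart hf ((z i : g) - posProj f (z i : g)) = cartanPart hf (z i : g) := by
    refine Subtype.ext ?_
    have h₁ := posProj_neg_posProj f (z i : g)
    have h₂ := posProj_of_mem (posProj_mem f (z i : g))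
    simp only [cartanPart, map_sub, h₁, h₂]
    abel
  rw [hcp] at htr
  have htr' : ∑ j, bracketForm B r (z i - pProj hB hBinv hr_cartan hf (z i))
      (pProj hB hBinv hr_cartan hf (z j)) (z j) = 2 * rho h f (cartanPart hf (z i : g)) := htr
  rw [htr', smul_smul]
  congr 1
  ring

variable {V : Type*} [AddCommGroup V] [Module ℂ V] [LieRingModule g V] [LieModule ℂ g V]
  {u : Cl B r} {lam : Module.Dual ℂ h} {v : V}

/-- `□` annihilates `v ⊗ l` if `𝔫 ∩ 𝔭` annihilates `l` from the left. -/
theorem xi_dirac_highestWeight_tmul (hB : B.IsSymm) (hBinv : B.lieInvariant g)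
    (hr_nondeg : (B.restrict r.toSubmodule).Nondegenerate)
    (hr_cartan : (hr h r).IsCartanSubalgebra) (hf : IsAdapted h r fr f)
    (hz : IsOrthonormalBasis B r z)
    (hlam : ∀ x : h, (x : g) ∈ pPart B r → (lam + rho h f) x = 0)
    (hV : IsIrreducibleHighestWeight h f lam V v) {l : leftIdeal B r u}
    (hl : ∀ x, ι (pQuad B r) (pProj hB hBinv hr_cartan hf x) * (l : Cl B r) = 0) :
    xi B r V u (dirac B r z) (v ⊗ₜ[ℂ] l) = 0 := by
  have hl' : ∀ x, ι (pQuad B r) (pProj hB hBinv hr_cartan hf x) • l = 0 :=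
    fun x => Subtype.ext (hl x)
  have hc : (equivExterior (pQuad B r)).symm
      (cubicElement B r z : ExteriorAlgebra ℂ (pPart B r)) • l =
        ∑ i, rho h f (cartanPart hf (z i : g)) • (ι (pQuad B r) (z i) • l) := by
    refine Subtype.ext ?_
    rw [Submodule.coe_sum]
    exact cubic_mul hB hBinv hr_nondeg hr_cartan hf hz hl
  have hswap := sum_dual_swap (pForm_isSymm hB) (sum_pForm_smul hz)
    (A := pProj hB hBinv hr_cartan hf.neg) (A' := pProj hB hBinv hr_cartan hf)
    (fun x y => by
      rw [(pForm_isSymm hB).eq, ← pForm_pProj_left hB hBinv hr_cartan hf, (pForm_isSymm hB).eq])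
    (fun x y => ⁅(x : g), v⁆ ⊗ₜ[ℂ] (ι (pQuad B r) y • l))
    (fun y => ⟨fun _ _ => by simp [TensorProduct.add_tmul],
      fun _ _ => by simp [TensorProduct.smul_tmul']⟩)
    (fun x => ⟨fun _ _ => by simp [add_smul, TensorProduct.tmul_add],
      fun c b => by
        rw [map_smul, smul_assoc]
        exact (TensorProduct.mk ℂ V (leftIdeal B r u) ⁅(x : g), v⁆).map_smul c _⟩)
  simp only [hl', TensorProduct.tmul_zero, Finset.sum_const_zero, coe_pProj] at hswap
  have hlie : ∀ i, ⁅(z i : g), v⁆ = lam (cartanPart hf (z i : g)) • v +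
      ⁅posProj (-f) (z i : g), v⁆ := by
    intro i
    conv_lhs => rw [eq_cartanPart_add hf (z i : g)]
    rw [add_lie, add_lie, hV.weight, hV.annihilated _ (posProj_mem f _), add_zero]
  rw [xi_dirac_tmul, hc]
  simp only [hlie, TensorProduct.add_tmul, Finset.sum_add_distrib]
  rw [hswap, add_zero, TensorProduct.tmul_sum, ← Finset.sum_add_distrib]
  refine Finset.sum_eq_zero fun i _ => ?_
  have hsmul : ∀ (a c : ℂ) (l : leftIdeal B r u),
      (a • v) ⊗ₜ[ℂ] l + v ⊗ₜ[ℂ] (c • l) = (a + c) • (v ⊗ₜ[ℂ] l) := fun a c l => by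
    rw [add_smul, TensorProduct.smul_tmul']
    exact congrArg _ ((TensorProduct.mk ℂ V (leftIdeal B r u) v).map_smul c l)
  rw [hsmul]
  have := hlam _ (cartanPart_mem_pPart hB hBinv hr_cartan hf (z i).2)
  rw [LinearMap.add_apply] at this
  rw [this, zero_smul]

/-- The pairing with a lowest weight vector `φ` of the dual module and an element which
`𝔫⁻ ∩ 𝔭` annihilates from the right vanishes on the image of `□`. -/
theorem pairing_xi_dirac (hB : B.IsSymm) (hBinv : B.lieInvariant g)
    (hr_nondeg : (B.restrict r.toSubmodule).Nondegenerate)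
    (hr_cartan : (hr h r).IsCartanSubalgebra) (hf : IsAdapted h r fr f)
    (hz : IsOrthonormalBasis B r z)
    (hlam : ∀ x : h, (x : g) ∈ pPart B r → (lam + rho h f) x = 0)
    {φ : Module.Dual ℂ V} (hφn : ∀ x ∈ nPart h (-f), ∀ y, φ ⁅x, y⁆ = 0)
    (hφh : ∀ (x : h) (y : V), φ ⁅(x : g), y⁆ = lam x * φ y) {s : Cl B r}
    (hs : ∀ x, s * ι (pQuad B r) (pProj hB hBinv hr_cartan hf.neg x) = 0)
    (t : V ⊗[ℂ] leftIdeal B r u) :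
    pairing B r u φ s (xi B r V u (dirac B r z) t) = 0 := by
  induction t using TensorProduct.induction_on with
  | zero => simp
  | add a b ha hb => rw [map_add, map_add, ha, hb, add_zero]
  | tmul y l =>
    have hc := mul_cubic hB hBinv hr_nondeg hr_cartan hf hz hs
    have hswap := sum_dual_swap (pForm_isSymm hB) (sum_pForm_smul hz)
      (pForm_pProj_left hB hBinv hr_cartan hf)
      (fun a b => φ ⁅(a : g), y⁆ • (s * ι (pQuad B r) b * (l : Cl B r)))
      (fun y => ⟨fun _ _ => by simp [add_smul], fun _ _ => by simp [mul_smul]⟩)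
      (fun x => ⟨fun _ _ => by simp [mul_add, add_mul], fun c b => by
        rw [map_smul, mul_smul_comm, smul_mul_assoc, smul_comm]⟩)
    simp only [hs, zero_mul, smul_zero, Finset.sum_const_zero, coe_pProj] at hswap
    have hlie : ∀ i, φ ⁅(z i : g), y⁆ = lam (cartanPart hf (z i : g)) * φ y +
        φ ⁅posProj f (z i : g), y⁆ := by
      intro i
      conv_lhs => rw [eq_cartanPart_add hf (z i : g)]
      rw [add_lie, add_lie, map_add, map_add, hφh, hφn _ (posProj_mem (-f) _), add_zero]
    rw [xi_dirac_tmul, map_add, map_sum, pairing_tmul]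
    simp only [pairing_tmul, Submodule.coe_smul, smul_eq_mul, ← mul_assoc, hlie, add_smul,
      Finset.sum_add_distrib]
    rw [hswap, add_zero, hc, Finset.sum_mul, Finset.smul_sum, ← Finset.sum_add_distrib]
    refine Finset.sum_eq_zero fun i _ => ?_
    rw [smul_mul_assoc, smul_smul, ← add_smul, mul_comm (φ y), ← add_mul]
    have := hlam _ (cartanPart_mem_pPart hB hBinv hr_cartan hf (z i).2)
    rw [LinearMap.add_apply] at this
    rw [this, zero_mul, zero_smul]

section Vacuum

variable {m : ℕ} (w : Module.Basis (Fin m) ℂ (np h B r f))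

theorem ι_mul_prod_basis (hB : B.IsSymm) (hBinv : B.lieInvariant g)
    (hr_cartan : (hr h r).IsCartanSubalgebra) (hf : IsAdapted h r fr f) {x : pPart B r}
    (hx : x ∈ np h B r f) :
    ι (pQuad B r) x * (List.ofFn fun i => ι (pQuad B r) (w i : pPart B r)).prod = 0 := by
  refine ι_mul_prod_eq_zero (fun i => (w i : pPart B r)) (fun y hy => ?_)
    (by rwa [span_range_coe_basis])
  rw [span_range_coe_basis] at hy
  change pForm B r y y = 0
  rw [← pProj_of_mem_np hB hBinv hr_cartan hf hy, pForm_pProj_left, pProj_neg_pProj, map_zero]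

/-- Right multiplication by the product of a basis of `𝔫 ∩ 𝔭` is injective on the subalgebra
generated by vectors without component in `𝔫`. -/
theorem eq_zero_of_mul_prod_basis_eq_zero (hB : B.IsSymm) (hBinv : B.lieInvariant g)
    (hr_cartan : (hr h r).IsCartanSubalgebra) (hf : IsAdapted h r fr f) {A : Set (pPart B r)}
    (hA : ∀ a ∈ A, pProj hB hBinv hr_cartan hf a = 0) {c : Cl B r}
    (hc : c ∈ Algebra.adjoin ℂ (ι (pQuad B r) '' A))
    (h0 : c * (List.ofFn fun i => ι (pQuad B r) (w i : pPart B r)).prod = 0) : c = 0 := by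
  let p : pPart B r →ₗ[ℂ] np h B r f :=
    (pProj hB hBinv hr_cartan hf).codRestrict (np h B r f) (pProj_mem_np hB hBinv hr_cartan hf)
  refine eq_zero_of_mul_prod_eq_zero (fun i => (w i : pPart B r)) (fun i => w.coord i ∘ₗ p)
    (fun i j => ?_) (fun i a ha => ?_) hc h0
  · have : p (w j) = w j := Subtype.ext (pProj_of_mem_np hB hBinv hr_cartan hf (w j).2)
    rw [LinearMap.comp_apply, this, Module.Basis.coord_apply, Module.Basis.repr_self,
      Finsupp.single_apply]
    simp only [eq_comm]
  · have : p a = 0 := Subtype.ext (hA a ha)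
    rw [LinearMap.comp_apply, this, map_zero]

theorem ι_mul_mul_prod_basis (hB : B.IsSymm) (hBinv : B.lieInvariant g)
    (hr_cartan : (hr h r).IsCartanSubalgebra) (hf : IsAdapted h r fr f) {c : Cl B r}
    (hc : c ∈ clSub B r (hp B h r)) (x : pPart B r) :
    ι (pQuad B r) (pProj hB hBinv hr_cartan hf x) *
      (c * (List.ofFn fun i => ι (pQuad B r) (w i : pPart B r)).prod) = 0 := by
  rw [← mul_assoc, ι_mul_eq_involute_mul (fun a ha => ?_) hc, mul_assoc,
    ι_mul_prod_basis w hB hBinv hr_cartan hf (pProj_mem_np hB hBinv hr_cartan hf x), mul_zero]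
  have h₁ : pForm B r (pProj hB hBinv hr_cartan hf x) a = 0 := by
    rw [pForm_pProj_left, pProj_of_mem_hp hB hBinv hr_cartan hf.neg ha, map_zero]
  have h₂ : pForm B r a (pProj hB hBinv hr_cartan hf x) = 0 := by
    rw [(pForm_isSymm hB).eq]; exact h₁
  change QuadraticMap.polar (pForm B r).toQuadraticMap _ _ = 0
  simp only [QuadraticMap.polar, LinearMap.BilinMap.toQuadraticMap_apply, map_add,
    LinearMap.add_apply, h₁, h₂]
  ring

variable (h B r f) in
/-- The element `u⁻`: the product, in reverse order, of a basis of `𝔫⁻ ∩ 𝔭`. -/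
def oppositeProd : Cl B r :=
  reverse (List.ofFn fun i =>
    ι (pQuad B r) (Module.finBasis ℂ (np h B r (-f)) i : pPart B r)).prod

theorem oppositeProd_mul_ι (hB : B.IsSymm) (hBinv : B.lieInvariant g)
    (hr_cartan : (hr h r).IsCartanSubalgebra) (hf : IsAdapted h r fr f) (x : pPart B r) :
    oppositeProd h B r f * ι (pQuad B r) (pProj hB hBinv hr_cartan hf.neg x) = 0 := by
  rw [oppositeProd, ← reverse_ι (Q := pQuad B r) (pProj _ _ _ _ x), ← reverse.map_mul,
    ι_mul_prod_basis _ hB hBinv hr_cartan hf.neg (pProj_mem_np hB hBinv hr_cartan hf.neg x),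
    map_zero]

/-- The map `c ↦ u⁻ c u` is injective on `C(𝔥 ∩ 𝔭)`: cancel `u`, then `u⁻` after a reversal. -/
theorem eq_zero_of_oppositeProd_mul_eq_zero (hB : B.IsSymm) (hBinv : B.lieInvariant g)
    (hr_cartan : (hr h r).IsCartanSubalgebra) (hf : IsAdapted h r fr f) {c : Cl B r}
    (hc : c ∈ clSub B r (hp B h r))
    (h0 : oppositeProd h B r f *
      (c * (List.ofFn fun i => ι (pQuad B r) (w i : pPart B r)).prod) = 0) : c = 0 := by
  have hA : ∀ a ∈ ((hp B h r : Set (pPart B r)) ∪ np h B r (-f)),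
      pProj hB hBinv hr_cartan hf a = 0 := by
    rintro a (ha | ha)
    · exact pProj_of_mem_hp hB hBinv hr_cartan hf ha
    · rw [← pProj_of_mem_np hB hBinv hr_cartan hf.neg ha]
      exact pProj_pProj_neg hB hBinv hr_cartan hf a
  have hmem : oppositeProd h B r f * c ∈ Algebra.adjoin ℂ
      (ι (pQuad B r) '' ((hp B h r : Set (pPart B r)) ∪ np h B r (-f))) := by
    refine mul_mem (reverse_mem_adjoin (Subalgebra.list_prod_mem _ fun x hx => ?_))
      (Algebra.adjoin_mono (Set.image_mono Set.subset_union_left) hc)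
    obtain ⟨i, rfl⟩ := (List.mem_ofFn' _ _).1 hx
    exact Algebra.subset_adjoin ⟨_, Or.inr (Module.finBasis ℂ (np h B r (-f)) i).2, rfl⟩
  rw [← mul_assoc] at h0
  have h₁ := eq_zero_of_mul_prod_basis_eq_zero w hB hBinv hr_cartan hf hA hmem h0
  have h₂ := congrArg reverse h₁
  rw [reverse.map_mul, oppositeProd, reverse_reverse, map_zero] at h₂
  have h₃ := eq_zero_of_mul_prod_basis_eq_zero _ hB hBinv hr_cartan hf.neg
    (fun a ha => pProj_of_mem_hp hB hBinv hr_cartan hf.neg ha) (reverse_mem_adjoin hc) h₂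
  rw [← reverse_reverse c, h₃, map_zero]

end Vacuum

end Dirac

/-! ### The dimension of `C(𝔞) u` -/

section LeftIdeal

variable {g : Type*} [LieRing g] [LieAlgebra ℂ g] {B : LinearMap.BilinForm ℂ g}
  {r : LieSubalgebra ℂ g} {u : Cl B r} {a : Submodule ℂ (pPart B r)}

theorem mem_clSubMul {l : leftIdeal B r u} :
    l ∈ clSubMul B r a u ↔ ∃ c ∈ clSub B r a, c * u = (l : Cl B r) := by
  simp [clSubMul]

theorem finrank_clSubMul [FiniteDimensional ℂ a] (hu : ∀ c ∈ clSub B r a, c * u = 0 → c = 0) :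
    Module.finrank ℂ (clSubMul B r a u) = 2 ^ Module.finrank ℂ a := by
  let F : clSub B r a →ₗ[ℂ] leftIdeal B r u :=
    { toFun := fun c => ⟨(c : Cl B r) * u, Submodule.mem_span_singleton.2 ⟨c, rfl⟩⟩
      map_add' := fun x y => Subtype.ext (add_mul _ _ _)
      map_smul' := fun c x => Subtype.ext (smul_mul_assoc _ _ _) }
  have hF : Function.Injective F := by
    rw [← LinearMap.ker_eq_bot, LinearMap.ker_eq_bot']
    intro c hc
    exact Subtype.ext (hu c c.2 (congrArg Subtype.val hc))
  have hrange : LinearMap.range F = clSubMul B r a u := by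
    ext l
    rw [mem_clSubMul]
    constructor
    · rintro ⟨c, rfl⟩
      exact ⟨c, c.2, rfl⟩
    · rintro ⟨c, hc, hl⟩
      exact ⟨⟨c, hc⟩, Subtype.ext hl⟩
  rw [← hrange, LinearMap.finrank_range_of_inj hF]
  exact finrank_adjoin (pQuad B r) a

end LeftIdeal

end CubicDirac

end

theorem theorem3p15
    {g : Type*} [LieRing g] [LieAlgebra ℂ g] [FiniteDimensional ℂ g]
    [LieAlgebra.IsSemisimple ℂ g]
    (B : LinearMap.BilinForm ℂ g) (hBsymm : B.IsSymm) (hBnondeg : B.Nondegenerate)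
    (hBinv : B.lieInvariant g)
    (r : LieSubalgebra ℂ g) (hr_reductive : CubicDirac.IsReductive r)
    (hr_nondeg : (B.restrict r.toSubmodule).Nondegenerate)
    (h : LieSubalgebra ℂ g) [h.IsCartanSubalgebra]
    (hr_cartan : (CubicDirac.hr h r).IsCartanSubalgebra)
    (fr f : h) (hf : CubicDirac.IsAdapted h r fr f)
    {ι : Type*} [Fintype ι] (z : Module.Basis ι ℂ (CubicDirac.pPart B r))
    (hz : CubicDirac.IsOrthonormalBasis B r z)
    {m : ℕ} (w : Module.Basis (Fin m) ℂ (CubicDirac.np h B r f))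
    (u : CubicDirac.Cl B r)
    (hu : u = (List.ofFn fun i =>
      CliffordAlgebra.ι (CubicDirac.pQuad B r) (w i : CubicDirac.pPart B r)).prod)
    (lam : Module.Dual ℂ h)
    (hlam : ∀ x : h, (x : g) ∈ CubicDirac.pPart B r → (lam + CubicDirac.rho h f) x = 0)
    {V : Type*} [AddCommGroup V] [Module ℂ V] [LieRingModule g V] [LieModule ℂ g V]
    (v : V) (hV : CubicDirac.IsIrreducibleHighestWeight h f lam V v) :
    Module.finrank ℂ (CubicDirac.clSubMul B r (CubicDirac.hp B h r) u) =
        2 ^ Module.finrank ℂ (CubicDirac.hp B h r) ∧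
      (∃ hE : CubicDirac.cocycleSpace B r V u (CubicDirac.hp B h r) v ≤
            LinearMap.ker (CubicDirac.xi B r V u (CubicDirac.dirac B r z)),
        Function.Injective (CubicDirac.toCohomology _ hE) ∧
          Module.finrank ℂ (LinearMap.range (CubicDirac.toCohomology _ hE)) =
            2 ^ Module.finrank ℂ (CubicDirac.hp B h r)) ∧
      Nontrivial
        (CubicDirac.Cohomology (CubicDirac.xi B r V u (CubicDirac.dirac B r z))) := by
  have hinj : ∀ c ∈ CubicDirac.clSub B r (CubicDirac.hp B h r), c * u = 0 → c = 0 := by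
    intro c hc h0
    rw [hu] at h0
    exact CubicDirac.eq_zero_of_mul_prod_basis_eq_zero w hBsymm hBinv hr_cartan hf
      (fun a ha => CubicDirac.pProj_of_mem_hp hBsymm hBinv hr_cartan hf ha) hc h0
  have hfin := CubicDirac.finrank_clSubMul hinj
  have hmap : CubicDirac.cocycleSpace B r V u (CubicDirac.hp B h r) v =
      (CubicDirac.clSubMul B r (CubicDirac.hp B h r) u).map
        (TensorProduct.mk ℂ V (CubicDirac.leftIdeal B r u) v) := by
    rw [CubicDirac.cocycleSpace, Submodule.map₂_span_singleton_eq_map]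
  have hE : CubicDirac.cocycleSpace B r V u (CubicDirac.hp B h r) v ≤
      LinearMap.ker (CubicDirac.xi B r V u (CubicDirac.dirac B r z)) := by
    rw [hmap]
    rintro _ ⟨l, hl, rfl⟩
    obtain ⟨c, hc, hcl⟩ := CubicDirac.mem_clSubMul.1 hl
    refine CubicDirac.xi_dirac_highestWeight_tmul hBsymm hBinv hr_nondeg hr_cartan
      hf hz hlam hV fun x => ?_
    rw [← hcl, hu]
    exact CubicDirac.ι_mul_mul_prod_basis w hBsymm hBinv hr_cartan hf hc x
  obtain ⟨φ, hφv, hφn, hφh⟩ := CubicDirac.exists_highestWeight_coordinate hf hV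
  have hinjE : Function.Injective (CubicDirac.toCohomology _ hE) := by
    rw [← LinearMap.ker_eq_bot, LinearMap.ker_eq_bot']
    rintro ⟨t, ht⟩ h0
    have hrange : t ∈ LinearMap.range (CubicDirac.xi B r V u (CubicDirac.dirac B r z)) :=
      (Submodule.Quotient.mk_eq_zero ((LinearMap.range
        (CubicDirac.xi B r V u (CubicDirac.dirac B r z))).submoduleOf _)).1 h0
    obtain ⟨t', rfl⟩ := hrange
    have hp0 := CubicDirac.pairing_xi_dirac hBsymm hBinv hr_nondeg hr_cartan hf hz hlam hφn
      hφh (CubicDirac.oppositeProd_mul_ι hBsymm hBinv hr_cartan hf) t'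
    have ht' := ht
    rw [hmap] at ht'
    obtain ⟨l, hl, hlt⟩ := ht'
    obtain ⟨c, hc, hcl⟩ := CubicDirac.mem_clSubMul.1 hl
    rw [← hlt, TensorProduct.mk_apply, CubicDirac.pairing_tmul, hφv, one_smul, ← hcl, hu] at hp0
    have hc0 := CubicDirac.eq_zero_of_oppositeProd_mul_eq_zero w hBsymm hBinv hr_cartan hf hc hp0
    have hl0 : l = 0 := Subtype.ext (by rw [← hcl, hc0, zero_mul]; rfl)
    refine Subtype.ext ?_
    change CubicDirac.xi B r V u (CubicDirac.dirac B r z) t' = 0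
    rw [← hlt, hl0, map_zero]
  have hrank : Module.finrank ℂ (LinearMap.range (CubicDirac.toCohomology _ hE)) =
      2 ^ Module.finrank ℂ (CubicDirac.hp B h r) := by
    have hmk : Function.Injective (TensorProduct.mk ℂ V (CubicDirac.leftIdeal B r u) v) := by
      refine Function.LeftInverse.injective
        (g := TensorProduct.lift (LinearMap.lsmul ℂ (CubicDirac.leftIdeal B r u) ∘ₗ φ)) fun l => ?_
      simp [hφv]
    rw [LinearMap.finrank_range_of_inj hinjE, hmap, ← hfin]
    exact (Submodule.equivMapOfInjective _ hmk _).finrank_eq.symm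
  refine ⟨hfin, ⟨hE, hinjE, hrank⟩, ?_⟩
  by_contra hsub
  rw [not_nontrivial_iff_subsingleton] at hsub
  rw [Module.finrank_zero_of_subsingleton] at hrank
  exact (pow_ne_zero _ two_ne_zero) hrank.symm
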